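/- Let $D$ be an integral domain with quotient field $K$, and let $\ast$ be a star-operation of finite character on $D$. That is, $A\mapsto A_\ast$ is a map from the set $F(D)$ of nonzero fractional ideals of $D$ to itself such that for all $A,B\in F(D)$ and $0\ne x\in K$: $(xD)_\ast=xD$, $(xA)_\ast=xA_\ast$; $A\subseteq A_\ast$, and $A\subseteq B$ implies $A_\ast\subseteq B_\ast$; $(A_\ast)_\ast=A_\ast$; and $A_\ast$ is the union of the $B_\ast$ over the nonzero finitely generated fractional ideals $B\subseteq A$. Definitions. Write $A^{-1}=\{x\in K: xA\subseteq D\}$ and $A_v=(A^{-1})^{-1}$. $A\in F(D)$ is $\ast$-invertible if $(AA^{-1})_\ast=D$. $\ast\text{-}\mathrm{Max}(D)$ is the set of ideals that are maximal among the nonzero proper ideals $I$ of $D$ with $I_\ast=I$; $X^{(1)}(D)$ is the set of height-one primes of $D$. A set $\mathscr F$ of primes of $D$ is a defining family if $D=\bigcap_{P\in\mathscr F}D_P$, is locally finite if every nonzero nonunit of $D$ lies in only finitely many members of $\mathscr F$, and is independent if no two distinct members of $\mathscr F$ contain a common nonzero prime ideal. $D$ is $\ast$-h-local if $\ast\text{-}\mathrm{Max}(D)$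 is an independent, locally finite defining family. A domain $R$ is an AV-domain if for all nonzero $a,b\in R$ there is $n\ge1$ with $a^n\mid b^n$ or $b^n\mid a^n$. $D$ is an AGCD-domain if for all nonzero $a,b\in D$ there is $n\ge 1$ with $(a^n,b^n)_v$ principal. $D$ is a $\ast$-AGKD if $X^{(1)}(D)$ is a locally finite defining family, $\ast\text{-}\mathrm{Max}(D)=X^{(1)}(D)$, and $D_P$ is an AV-domain for each $P\in\ast\text{-}\mathrm{Max}(D)$. $Cl_\ast(D)$ is the group of $\ast$-invertible fractional ideals $A$ with $A_\ast=A$, under $(A,B)\mapsto(AB)_\ast$, modulo the subgroup of nonzero principal fractional ideals. A nonzero finitely generated ideal $A$ of $D$ is $\ast$-homogeneous if it is contained in exactly one member $M(A)$ of $\ast\text{-}\mathrm{Max}(D)$; it is then of type 1 if $M(A)=\sqrt{A_\ast}$. $A$ is $\ast$-afg-homogeneous if it is $\ast$-invertible and $\ast$-homogeneous and, whenever $b_1,\dots,b_s\in M(A)$ satisfy $A^r\subseteq(b_1,\dots,b_s)_\ast$ for some $r\ge1$, there is $n\ge1$ with $(b_1^n,\dots,b_s^n)_\ast$ principal. An ideal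 $I$ is a $\ast$-product of ideals with a given property if $I=(A_1\cdots A_k)_\ast$ for finitely many ideals $A_i$ of $D$ with that property. $D$ is a type 1 $\ast$-afg-SH domain if every nonzero proper principal ideal of $D$ is a $\ast$-product of type 1 $\ast$-afg-homogeneous ideals. Then the following statements are equivalent: 1. $D$ is a type 1 $\ast$-afg-SH domain. 2. $D$ is a $\ast$-AGKD and an AGCD-domain. 3. $D$ is $\ast$-h-local and every $\ast$-invertible $\ast$-homogeneous ideal of $D$ is $\ast$-afg-homogeneous of type 1. 4. For every $\ast$-invertible finitely generated ideal $A$ of $D$ with $A_\ast\neq D$, the ideal $A_\ast$ is a $\ast$-product of type 1 $\ast$-afg-homogeneous ideals. 5. $D$ is a $\ast$-AGKD and $Cl_\ast(D)$ is a torsion group. -/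

import Mathlib

open scoped nonZeroDivisors

section StarOperations

open FractionalIdeal

variable {D : Type*} [CommRing D] [IsDomain D]
variable {K : Type*} [Field K] [Algebra D K] [IsFractionRing D K]

variable (D K) in
/-- A star-operation on the domain `D` with quotient field `K`. It is a map on the nonzero
fractional ideals; here it is extended to all fractional ideals by the harmless convention
that the closure of `0` is `0` (the case `x = 0` of `cl_spanSingleton`), under which each of
the usual axioms for nonzero `A`, `B`, `x` is equivalent to the axiom written below. -/
structure StarOperation where
  /-- the closure `A ↦ A_*` -/
  cl : FractionalIdeal D⁰ K → FractionalIdeal D⁰ K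
  cl_spanSingleton : ∀ x : K, cl (spanSingleton D⁰ x) = spanSingleton D⁰ x
  cl_spanSingleton_mul : ∀ (x : K) (A : FractionalIdeal D⁰ K),
    cl (spanSingleton D⁰ x * A) = spanSingleton D⁰ x * cl A
  le_cl : ∀ A : FractionalIdeal D⁰ K, A ≤ cl A
  cl_mono : ∀ A B : FractionalIdeal D⁰ K, A ≤ B → cl A ≤ cl B
  cl_cl : ∀ A : FractionalIdeal D⁰ K, cl (cl A) = cl A

/-- `D_P`, as a subset of the quotient field `K`. -/
def localizationIn (K : Type*) [Field K] [Algebra D K] (P : Ideal D) : Set K :=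
  {x | ∃ a s : D, s ∉ P ∧ x = algebraMap D K a / algebraMap D K s}

/-- A set `F` of prime ideals of `D` with `D = ⋂ {D_P | P ∈ F}`. -/
def IsDefiningFamily (K : Type*) [Field K] [Algebra D K] (F : Set (Ideal D)) : Prop :=
  (∀ P ∈ F, P.IsPrime) ∧ (⋂ P ∈ F, localizationIn K P) = Set.range (algebraMap D K)

/-- Every nonzero nonunit of `D` lies in at most finitely many members of `F`. -/
def IsLocallyFiniteFamily (F : Set (Ideal D)) : Prop :=
  ∀ x : D, x ≠ 0 → ¬ IsUnit x → {P ∈ F | x ∈ P}.Finite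

/-- No two (distinct) members of `F` contain a common nonzero prime ideal. -/
def IsIndependentFamily (F : Set (Ideal D)) : Prop :=
  ∀ P ∈ F, ∀ Q ∈ F, P ≠ Q → ¬ ∃ N : Ideal D, N.IsPrime ∧ N ≠ ⊥ ∧ N ≤ P ∧ N ≤ Q

variable (D) in
/-- `X⁽¹⁾(D)`, the set of height-one prime ideals. -/
def heightOnePrimes : Set (Ideal D) := {P | P.IsPrime ∧ P.height = 1}

/-- Almost valuation domain: of any two nonzero elements, some positive power of one divides
the same power of the other. -/
def IsAlmostValuationDomain (R : Type*) [CommRing R] : Prop :=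
  IsDomain R ∧ ∀ a b : R, a ≠ 0 → b ≠ 0 → ∃ n : ℕ, 0 < n ∧ (a ^ n ∣ b ^ n ∨ b ^ n ∣ a ^ n)

/-- A fractional ideal of the form `cD`. -/
def IsPrincipalFractional (A : FractionalIdeal D⁰ K) : Prop :=
  ∃ c : K, A = spanSingleton D⁰ c

variable (D K) in
/-- Almost GCD domain: for nonzero `a, b` in `D` there is `n ≥ 1` such that
`(aⁿ, bⁿ)_v = ((aⁿ, bⁿ)⁻¹)⁻¹` is principal. -/
def IsAGCDDomain : Prop :=
  ∀ a b : D, a ≠ 0 → b ≠ 0 → ∃ n : ℕ, 0 < n ∧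
    IsPrincipalFractional ((Ideal.span {a ^ n, b ^ n} : FractionalIdeal D⁰ K)⁻¹)⁻¹

namespace StarOperation

variable (star : StarOperation D K)

/-- Finite character: `A_*` is the union of the `B_*`, `B` a nonzero finitely generated
fractional ideal contained in `A`. -/
def IsFiniteCharacter : Prop :=
  ∀ A : FractionalIdeal D⁰ K, A ≠ 0 → ∀ x : K, x ∈ star.cl A ↔
    ∃ B : FractionalIdeal D⁰ K, B ≠ 0 ∧ (B : Submodule D K).FG ∧ B ≤ A ∧ x ∈ star.cl B

/-- `A` is `*`-invertible: `A` is nonzero and `(A A⁻¹)_* = D`. -/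
def IsInvertible (A : FractionalIdeal D⁰ K) : Prop :=
  A ≠ 0 ∧ star.cl (A * A⁻¹) = 1

/-- The closure `A_*` of an ideal `A` of `D`, as an ideal of `D`. -/
def idealCl (A : Ideal D) : Ideal D :=
  (star.cl (A : FractionalIdeal D⁰ K) : Submodule D K).comap (Algebra.linearMap D K)

/-- `*-Max(D)`: the ideals maximal among the nonzero proper ideals `I` of `D` with `I_* = I`. -/
def maxIdeals : Set (Ideal D) :=
  {P | Maximal (fun I : Ideal D => I ≠ ⊥ ∧ I ≠ ⊤ ∧
    star.cl (I : FractionalIdeal D⁰ K) = (I : FractionalIdeal D⁰ K)) P}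

/-- `A` is a nonzero finitely generated ideal and `P` is the only maximal `*`-ideal
containing it. -/
def IsHomogeneousAt (P A : Ideal D) : Prop :=
  A ≠ ⊥ ∧ A.FG ∧ P ∈ star.maxIdeals ∧ A ≤ P ∧ ∀ Q ∈ star.maxIdeals, A ≤ Q → Q = P

/-- `A` is `*`-homogeneous. -/
def IsHomogeneous (A : Ideal D) : Prop := ∃ P : Ideal D, star.IsHomogeneousAt P A

/-- `A` is `*`-homogeneous of type 1: `M(A) = √(A_*)`. -/
def IsTypeOneHomogeneous (A : Ideal D) : Prop :=
  ∃ P : Ideal D, star.IsHomogeneousAt P A ∧ P = (star.idealCl A).radical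

/-- `A` is `*`-almost factorial general-homogeneous: it is `*`-invertible and
`P`-`*`-homogeneous and, whenever `b₁, …, b_s ∈ P` and `Aʳ ⊆ (b₁, …, b_s)_*` for some `r ≥ 1`,
there is `n ≥ 1` with `(b₁ⁿ, …, b_sⁿ)_*` principal. -/
def IsAfgHomogeneous (A : Ideal D) : Prop :=
  star.IsInvertible (A : FractionalIdeal D⁰ K) ∧
  ∃ P : Ideal D, star.IsHomogeneousAt P A ∧
    ∀ (s : ℕ) (b : Fin s → D), (∀ i, b i ∈ P) →
      (∃ r : ℕ, 0 < r ∧ ((A ^ r : Ideal D) : FractionalIdeal D⁰ K) ≤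
        star.cl (Ideal.span (Set.range b) : FractionalIdeal D⁰ K)) →
      ∃ n : ℕ, 0 < n ∧ IsPrincipalFractional
        (star.cl (Ideal.span (Set.range fun i => b i ^ n) : FractionalIdeal D⁰ K))

/-- `A` is `*`-afg-homogeneous of type 1. -/
def IsTypeOneAfgHomogeneous (A : Ideal D) : Prop :=
  star.IsAfgHomogeneous A ∧ star.IsTypeOneHomogeneous A

/-- `A_*` is a (finite) `*`-product `(A₁ ⋯ A_k)_*` of ideals of `D` satisfying `p`. -/
def IsStarProductOf (p : Ideal D → Prop) (A : Ideal D) : Prop :=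
  ∃ l : List (Ideal D), (∀ B ∈ l, p B) ∧
    star.cl (A : FractionalIdeal D⁰ K) = star.cl (l.prod : FractionalIdeal D⁰ K)

/-- `D` is a type 1 `*`-afg-SH domain: every nonzero proper principal ideal is a `*`-product of
type 1 `*`-afg-homogeneous ideals. (A principal ideal equals its closure.) -/
def IsTypeOneAfgSHDomain : Prop :=
  ∀ x : D, x ≠ 0 → ¬ IsUnit x →
    star.IsStarProductOf star.IsTypeOneAfgHomogeneous (Ideal.span {x})

/-- `D` is `*`-h-local: `*-Max(D)` is an independent defining family of finite character. -/
def IsHLocal : Prop :=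
  IsDefiningFamily K star.maxIdeals ∧ IsIndependentFamily star.maxIdeals ∧
    IsLocallyFiniteFamily star.maxIdeals

/-- `D` is a `*`-almost generalized Krull domain. -/
def IsAGKD : Prop :=
  (IsDefiningFamily K (heightOnePrimes D) ∧ IsLocallyFiniteFamily (heightOnePrimes D)) ∧
  star.maxIdeals = heightOnePrimes D ∧
  ∀ (P : Ideal D) [P.IsPrime], P ∈ star.maxIdeals →
    IsAlmostValuationDomain (Localization.AtPrime P)

/-! The `*`-class group. -/

theorem cl_one : star.cl 1 = 1 := by
  simpa using star.cl_spanSingleton 1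

theorem cl_mul_le (A B : FractionalIdeal D⁰ K) : star.cl A * B ≤ star.cl (A * B) := by
  refine mul_le.2 fun x hx y hy => ?_
  have h1 : y * x ∈ spanSingleton D⁰ y * star.cl A :=
    mul_mem_mul (mem_spanSingleton_self D⁰ y) hx
  rw [← star.cl_spanSingleton_mul] at h1
  have h2 : spanSingleton D⁰ y * A ≤ A * B := by
    rw [mul_comm A B]
    exact mul_le_mul_left (spanSingleton_le_iff_mem.2 hy) A
  rw [mul_comm x y]
  exact star.cl_mono _ _ h2 h1

theorem cl_cl_mul (A B : FractionalIdeal D⁰ K) : star.cl (star.cl A * B) = star.cl (A * B) := by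
  refine le_antisymm ?_ (star.cl_mono _ _ (mul_le_mul_left (star.le_cl A) B))
  have h := star.cl_mono _ _ (star.cl_mul_le A B)
  rwa [star.cl_cl] at h

theorem cl_mul_cl (A B : FractionalIdeal D⁰ K) : star.cl (A * star.cl B) = star.cl (A * B) := by
  rw [mul_comm, cl_cl_mul, mul_comm]

/-- If `(A B)_* = D` then `A` is `*`-invertible. -/
theorem isInvertible_of_mul {A B : FractionalIdeal D⁰ K} (h : star.cl (A * B) = 1) :
    star.IsInvertible A := by
  have hA : A ≠ 0 := by
    rintro rfl
    have h0 : star.cl (0 : FractionalIdeal D⁰ K) = 0 := by simpa using star.cl_spanSingleton 0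
    rw [zero_mul, h0] at h
    exact zero_ne_one h
  refine ⟨hA, le_antisymm ?_ ?_⟩
  · rw [← star.cl_one]
    exact star.cl_mono _ _ mul_one_div_le_one
  · rw [← h]
    refine star.cl_mono _ _ ?_
    have hB : B ≤ A⁻¹ := by
      refine (le_div_iff_mul_le hA).2 ?_
      rw [mul_comm, ← h]
      exact star.le_cl _
    rw [mul_comm A, mul_comm A]
    exact mul_le_mul_left hB A

/-- `*-Inv(D)`: the `*`-invertible fractional `*`-ideals. -/
def Inv : Type _ := {A : FractionalIdeal D⁰ K // star.IsInvertible A ∧ star.cl A = A}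

/-- The group structure of `*-Inv(D)` given by the `*`-product `(A B)_*`. -/
noncomputable instance : CommGroup star.Inv where
  mul A B := ⟨star.cl (A.1 * B.1), by
    refine ⟨star.isInvertible_of_mul (B := A.1⁻¹ * B.1⁻¹) ?_, star.cl_cl _⟩
    rw [cl_cl_mul, mul_mul_mul_comm, ← cl_cl_mul, A.2.1.2, one_mul, B.2.1.2]⟩
  one := ⟨1, star.isInvertible_of_mul (B := 1) (by rw [mul_one, cl_one]), star.cl_one⟩
  inv A := ⟨star.cl A.1⁻¹, by
    refine ⟨star.isInvertible_of_mul (B := A.1) ?_, star.cl_cl _⟩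
    rw [cl_cl_mul, mul_comm, A.2.1.2]⟩
  mul_assoc A B C := Subtype.ext <| by
    change star.cl (star.cl (A.1 * B.1) * C.1) = star.cl (A.1 * star.cl (B.1 * C.1))
    rw [cl_cl_mul, cl_mul_cl, mul_assoc]
  one_mul A := Subtype.ext <| by
    change star.cl (1 * A.1) = A.1
    rw [one_mul, A.2.2]
  mul_one A := Subtype.ext <| by
    change star.cl (A.1 * 1) = A.1
    rw [mul_one, A.2.2]
  inv_mul_cancel A := Subtype.ext <| by
    change star.cl (star.cl A.1⁻¹ * A.1) = 1
    rw [cl_cl_mul, mul_comm, A.2.1.2]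
  mul_comm A B := Subtype.ext <| by
    change star.cl (A.1 * B.1) = star.cl (B.1 * A.1)
    rw [mul_comm]

theorem isInvertible_spanSingleton {x : K} (hx : x ≠ 0) :
    star.IsInvertible (spanSingleton D⁰ x) :=
  star.isInvertible_of_mul (B := spanSingleton D⁰ x⁻¹) <| by
    rw [spanSingleton_mul_spanSingleton, mul_inv_cancel₀ hx, star.cl_spanSingleton,
      spanSingleton_one]

/-- The homomorphism sending `x ∈ K \ {0}` to the principal fractional ideal `xD`. -/
noncomputable def toPrin : Kˣ →* star.Inv where
  toFun x := ⟨spanSingleton D⁰ (x : K), star.isInvertible_spanSingleton x.ne_zero,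
    star.cl_spanSingleton _⟩
  map_one' := Subtype.ext <| by
    change spanSingleton D⁰ ((1 : Kˣ) : K) = 1
    rw [Units.val_one, spanSingleton_one]
  map_mul' x y := Subtype.ext <| by
    change spanSingleton D⁰ ((x * y : Kˣ) : K) =
      star.cl (spanSingleton D⁰ (x : K) * spanSingleton D⁰ (y : K))
    rw [spanSingleton_mul_spanSingleton, star.cl_spanSingleton, Units.val_mul]

/-- The `*`-class group `Cl_*(D) = *-Inv(D) / Prin(D)`. -/
abbrev ClassGroup : Type _ := star.Inv ⧸ star.toPrin.range

end StarOperation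

end StarOperations

/-! ### Closures and `*`-invertibility of integral ideals. -/

namespace StarOperation

open FractionalIdeal

variable {D : Type*} [CommRing D] [IsDomain D]
variable {K : Type*} [Field K] [Algebra D K] [IsFractionRing D K]
variable (star : StarOperation D K)

/-! Finite character makes closures local: `y ∈ A_*` as soon as `y ∈ A D_P` for all `P` in
`*-Max(D)` (`IsFiniteCharacter.mem_idealCl`). So a nonzero ideal is `*`-invertible exactly when it
is locally principal at each such `P`, and then one of its given generators generates locally.
Hence, if `(b₁, …, b_s)` is `*`-invertible, its `n`-th power and `(b₁ⁿ, …, b_sⁿ)` have the same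
closure (`idealCl_span_pow`). This exchanges torsion in the class group for principality of ideals
of powers.

From (1), every nonzero prime contains a type 1 factor `C` of a principal ideal. Local principality
and `√(C_*) = M(C)` force `*-Max(D) = X⁽¹⁾(D)`. Testing the afg condition on `a`, `b` and the
generators of a power of `C` gives the AV property. Splitting a `*`-invertible ideal into
homogeneous components and testing each on its own generators gives torsion, hence (5).

From (5), if `Aʳ ⊆ (b₁, …, b_s)_*` with `A` homogeneous at `P`, only `P` can contain all the `b_i`.
The AV property at `P` makes some `(b₁ⁿ, …, b_sⁿ)` `*`-invertible, and torsion makes a further power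
principal, which is (3). The component decomposition gives (4), and (1) is a special case of (4).

For (2) and (5), local finiteness and the AV property make `(aⁿ, bⁿ)` `*`-invertible for some `n`.
There the `v`- and `*`-closures agree, so the AGCD condition amounts to torsion. -/

theorem cl_coeIdeal_le_one (A : Ideal D) : star.cl (A : FractionalIdeal D⁰ K) ≤ 1 := by
  rw [← star.cl_one]
  exact star.cl_mono _ _ coeIdeal_le_one

omit [IsDomain D] in
theorem mem_idealCl {A : Ideal D} {x : D} :
    x ∈ star.idealCl A ↔ algebraMap D K x ∈ star.cl (A : FractionalIdeal D⁰ K) :=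
  Iff.rfl

theorem coeIdeal_idealCl (A : Ideal D) :
    (star.idealCl A : FractionalIdeal D⁰ K) = star.cl (A : FractionalIdeal D⁰ K) := by
  obtain ⟨B, hB⟩ := le_one_iff_exists_coeIdeal.1 (star.cl_coeIdeal_le_one A)
  have : star.idealCl A = B := by
    ext x
    rw [mem_idealCl, ← hB, mem_coeIdeal]
    constructor
    · rintro ⟨y, hy, h⟩
      rwa [← IsFractionRing.injective D K h]
    · intro hx
      exact ⟨x, hx, rfl⟩
  rw [this, hB]

theorem idealCl_eq_iff {A B : Ideal D} : star.idealCl A = star.idealCl B ↔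
    star.cl (A : FractionalIdeal D⁰ K) = star.cl (B : FractionalIdeal D⁰ K) := by
  rw [← coeIdeal_idealCl, ← coeIdeal_idealCl, coeIdeal_inj]

theorem idealCl_eq_self_iff {A : Ideal D} : star.idealCl A = A ↔
    star.cl (A : FractionalIdeal D⁰ K) = (A : FractionalIdeal D⁰ K) := by
  rw [← coeIdeal_idealCl, coeIdeal_inj]

theorem le_idealCl (A : Ideal D) : A ≤ star.idealCl A := by
  rw [← coeIdeal_le_coeIdeal K, coeIdeal_idealCl]
  exact star.le_cl _

theorem idealCl_mono {A B : Ideal D} (h : A ≤ B) : star.idealCl A ≤ star.idealCl B := by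
  rw [← coeIdeal_le_coeIdeal K, coeIdeal_idealCl, coeIdeal_idealCl]
  exact star.cl_mono _ _ ((coeIdeal_le_coeIdeal K).2 h)

theorem idealCl_idealCl (A : Ideal D) : star.idealCl (star.idealCl A) = star.idealCl A := by
  rw [idealCl_eq_iff, coeIdeal_idealCl, star.cl_cl]

theorem idealCl_le_iff {A B : Ideal D} :
    star.idealCl A ≤ star.idealCl B ↔ A ≤ star.idealCl B :=
  ⟨(star.le_idealCl A).trans, fun h => (star.idealCl_mono h).trans (star.idealCl_idealCl B).le⟩

theorem idealCl_mul_idealCl (A B : Ideal D) :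
    star.idealCl (A * star.idealCl B) = star.idealCl (A * B) := by
  rw [idealCl_eq_iff, coeIdeal_mul, coeIdeal_mul, coeIdeal_idealCl, star.cl_mul_cl]

theorem idealCl_idealCl_mul (A B : Ideal D) :
    star.idealCl (star.idealCl A * B) = star.idealCl (A * B) := by
  rw [mul_comm, idealCl_mul_idealCl, mul_comm]

theorem idealCl_span_singleton_mul (x : D) (A : Ideal D) :
    star.idealCl (Ideal.span {x} * A) = Ideal.span {x} * star.idealCl A := by
  apply coeIdeal_injective (K := K)
  dsimp only
  rw [coeIdeal_idealCl, coeIdeal_mul, coeIdeal_mul, coeIdeal_idealCl, coeIdeal_span_singleton,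
    star.cl_spanSingleton_mul]

theorem idealCl_top : star.idealCl (⊤ : Ideal D) = ⊤ :=
  top_le_iff.1 (star.le_idealCl ⊤)

theorem idealCl_span_singleton (x : D) : star.idealCl (Ideal.span {x}) = Ideal.span {x} := by
  have h := star.idealCl_span_singleton_mul x ⊤
  rwa [idealCl_top, Ideal.mul_top] at h

theorem idealCl_bot : star.idealCl (⊥ : Ideal D) = ⊥ := by
  have h := star.idealCl_span_singleton 0
  rwa [Ideal.span_singleton_zero] at h

theorem idealCl_sup_idealCl (A B : Ideal D) :
    star.idealCl (A ⊔ star.idealCl B) = star.idealCl (A ⊔ B) :=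
  le_antisymm (star.idealCl_le_iff.2 (sup_le (le_sup_left.trans (star.le_idealCl _))
    (star.idealCl_mono le_sup_right))) (star.idealCl_mono (sup_le_sup_left (star.le_idealCl B) A))

theorem idealCl_pow_idealCl (A : Ideal D) (n : ℕ) :
    star.idealCl (star.idealCl A ^ n) = star.idealCl (A ^ n) := by
  induction n with
  | zero => rw [pow_zero, pow_zero]
  | succ n ih =>
    rw [pow_succ, pow_succ, idealCl_mul_idealCl, ← idealCl_idealCl_mul, ih, idealCl_idealCl_mul]

theorem pow_idealCl_le (A : Ideal D) (n : ℕ) : star.idealCl A ^ n ≤ star.idealCl (A ^ n) :=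
  (star.le_idealCl _).trans (star.idealCl_pow_idealCl A n).le

theorem cl_eq_one_iff {A : Ideal D} :
    star.cl (A : FractionalIdeal D⁰ K) = 1 ↔ star.idealCl A = ⊤ := by
  rw [← coeIdeal_idealCl, ← coeIdeal_top D⁰ (P := K), coeIdeal_inj]

theorem le_cl_coeIdeal_iff {A B : Ideal D} :
    (A : FractionalIdeal D⁰ K) ≤ star.cl (B : FractionalIdeal D⁰ K) ↔ A ≤ star.idealCl B := by
  rw [← coeIdeal_idealCl, coeIdeal_le_coeIdeal]

omit [IsDomain D] in
theorem isPrincipalFractional_coeIdeal_iff {A : Ideal D} :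
    IsPrincipalFractional (A : FractionalIdeal D⁰ K) ↔ ∃ d : D, A = Ideal.span {d} := by
  constructor
  · rintro ⟨c, hc⟩
    have h : c ∈ (A : FractionalIdeal D⁰ K) := hc ▸ mem_spanSingleton_self D⁰ c
    obtain ⟨d, -, rfl⟩ := (mem_coeIdeal D⁰).1 h
    refine ⟨d, coeIdeal_injective (K := K) ?_⟩
    dsimp only
    rw [hc, coeIdeal_span_singleton]
  · rintro ⟨d, rfl⟩
    exact ⟨algebraMap D K d, coeIdeal_span_singleton d⟩

theorem isPrincipalFractional_cl_iff {A : Ideal D} :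
    IsPrincipalFractional (star.cl (A : FractionalIdeal D⁰ K)) ↔
      ∃ d : D, star.idealCl A = Ideal.span {d} := by
  rw [← coeIdeal_idealCl, isPrincipalFractional_coeIdeal_iff]

theorem isStarProductOf_iff {p : Ideal D → Prop} {A : Ideal D} : star.IsStarProductOf p A ↔
    ∃ l : List (Ideal D), (∀ B ∈ l, p B) ∧ star.idealCl A = star.idealCl l.prod := by
  simp only [IsStarProductOf, idealCl_eq_iff]

/-- An ideal `A` is `*`-invertible iff some multiple of it has a nonzero principal closure. -/
theorem isInvertible_coeIdeal_iff {A : Ideal D} :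
    star.IsInvertible (A : FractionalIdeal D⁰ K) ↔
      ∃ B : Ideal D, ∃ d : D, d ≠ 0 ∧ star.idealCl (A * B) = Ideal.span {d} := by
  constructor
  · rintro ⟨-, h⟩
    -- Clear denominators: the inverse of `A` is `d⁻¹B` with `B` integral.
    obtain ⟨d, B, hd, hB⟩ := exists_eq_spanSingleton_mul (A : FractionalIdeal D⁰ K)⁻¹
    have hd' : algebraMap D K d ≠ 0 := by
      simpa using hd
    refine ⟨B, d, hd, coeIdeal_injective (K := K) ?_⟩
    dsimp only
    rw [coeIdeal_idealCl, coeIdeal_mul, coeIdeal_span_singleton]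
    rw [hB, mul_left_comm, star.cl_spanSingleton_mul] at h
    rw [← mul_one (spanSingleton D⁰ (algebraMap D K d)), ← h, ← mul_assoc,
      spanSingleton_mul_spanSingleton, mul_inv_cancel₀ hd', spanSingleton_one, one_mul]
  · rintro ⟨B, d, hd, h⟩
    have hd' : algebraMap D K d ≠ 0 := by
      simpa using hd
    refine star.isInvertible_of_mul (B := spanSingleton D⁰ (algebraMap D K d)⁻¹ * B) ?_
    rw [mul_left_comm, star.cl_spanSingleton_mul, ← coeIdeal_mul, ← coeIdeal_idealCl, h,
      coeIdeal_span_singleton, spanSingleton_mul_spanSingleton, inv_mul_cancel₀ hd',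
      spanSingleton_one]

variable {star}

theorem IsInvertible.ne_bot {A : Ideal D} (hA : star.IsInvertible (A : FractionalIdeal D⁰ K)) :
    A ≠ ⊥ :=
  coeIdeal_ne_zero.1 hA.1

theorem isInvertible_of_idealCl_eq_span_singleton {A : Ideal D} {d : D} (hd : d ≠ 0)
    (h : star.idealCl A = Ideal.span {d}) : star.IsInvertible (A : FractionalIdeal D⁰ K) :=
  star.isInvertible_coeIdeal_iff.2 ⟨⊤, d, hd, by rwa [Ideal.mul_top]⟩

theorem isInvertible_span_singleton {d : D} (hd : d ≠ 0) :
    star.IsInvertible ((Ideal.span {d} : Ideal D) : FractionalIdeal D⁰ K) :=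
  isInvertible_of_idealCl_eq_span_singleton hd (star.idealCl_span_singleton d)

theorem span_singleton_mul_cancel {d : D} (hd : d ≠ 0) {A B : Ideal D}
    (h : Ideal.span {d} * A = Ideal.span {d} * B) : A = B :=
  (Ideal.span_singleton_mul_right_inj hd).1 h

/-- For a `*`-invertible fractional ideal `B` one has `B_v = B_*`. -/
theorem IsInvertible.inv_inv {B : FractionalIdeal D⁰ K} (hB : star.IsInvertible B) :
    (B⁻¹)⁻¹ = star.cl B := by
  have h1 : B * B⁻¹ ≤ 1 := mul_one_div_le_one
  have hB' : B⁻¹ ≠ 0 := by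
    intro h
    have h0 : star.cl (0 : FractionalIdeal D⁰ K) = 0 := by simpa using star.cl_spanSingleton 0
    have := hB.2
    rw [h, mul_zero, h0] at this
    exact zero_ne_one this
  have h2 : B⁻¹ * (B⁻¹)⁻¹ ≤ 1 := mul_one_div_le_one
  apply le_antisymm
  · calc (B⁻¹)⁻¹ = star.cl (B * B⁻¹) * (B⁻¹)⁻¹ := by rw [hB.2, one_mul]
      _ ≤ star.cl (B * B⁻¹ * (B⁻¹)⁻¹) := star.cl_mul_le _ _
      _ ≤ star.cl B := by
        refine star.cl_mono _ _ ?_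
        rw [mul_assoc]
        exact (mul_le_mul_right h2 B).trans (mul_one B).le
  · refine (le_div_iff_mul_le hB').2 ?_
    refine (star.cl_mul_le _ _).trans ?_
    rw [← star.cl_one]
    exact star.cl_mono _ _ h1

end StarOperation

/-! ### Saturation and local principality at a prime. -/

section Saturation

variable {D : Type*} [CommRing D]

/-- The ideal `A D_P ∩ D`. -/
def primeSaturation (P A : Ideal D) [P.IsPrime] : Ideal D where
  carrier := {y | ∃ s ∉ P, s * y ∈ A}
  add_mem' := by
    rintro x y ⟨s, hs, hsx⟩ ⟨t, ht, hty⟩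
    refine ⟨s * t, fun h => (Ideal.IsPrime.mem_or_mem ‹_› h).elim hs ht, ?_⟩
    have := A.add_mem (A.mul_mem_left t hsx) (A.mul_mem_left s hty)
    convert this using 1
    ring
  zero_mem' := ⟨1, P.one_notMem, by simp⟩
  smul_mem' := by
    rintro c x ⟨s, hs, hsx⟩
    refine ⟨s, hs, ?_⟩
    have := A.mul_mem_left c hsx
    convert this using 1
    simp only [smul_eq_mul]
    ring

theorem le_primeSaturation (P A : Ideal D) [P.IsPrime] : A ≤ primeSaturation P A :=
  fun y hy => ⟨1, P.one_notMem, by rwa [one_mul]⟩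

theorem exists_forall_mul_mem_of_le_primeSaturation {P A B : Ideal D} [hP : P.IsPrime]
    (hB : B.FG) (h : B ≤ primeSaturation P A) : ∃ s ∉ P, ∀ y ∈ B, s * y ∈ A := by
  induction B, hB using Submodule.fg_induction with
  | singleton x =>
    obtain ⟨s, hs, hx⟩ := h (Ideal.mem_span_singleton_self x)
    refine ⟨s, hs, fun y hy => ?_⟩
    obtain ⟨c, rfl⟩ := Ideal.mem_span_singleton'.1 hy
    rw [mul_left_comm]
    exact A.mul_mem_left c hx
  | sup B₁ B₂ h₁ h₂ ih₁ ih₂ =>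
    obtain ⟨s, hs, hx⟩ := ih₁ (le_sup_left.trans h)
    obtain ⟨t, ht, hy⟩ := ih₂ (le_sup_right.trans h)
    refine ⟨s * t, fun h => (hP.mem_or_mem h).elim hs ht, fun z hz => ?_⟩
    obtain ⟨u, hu, v, hv, rfl⟩ := Submodule.mem_sup.1 hz
    have := A.add_mem (A.mul_mem_left t (hx u hu)) (A.mul_mem_left s (hy v hv))
    convert this using 1
    ring

/-- `A D_P` is generated by a single element of `A`. -/
def IsLocallyPrincipalAt (P A : Ideal D) : Prop :=
  ∃ a ∈ A, ∃ s ∉ P, ∀ y ∈ A, a ∣ s * y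

theorem IsLocallyPrincipalAt.of_not_le {P A : Ideal D} (h : ¬ A ≤ P) :
    IsLocallyPrincipalAt P A := by
  obtain ⟨a, ha, haP⟩ := SetLike.not_le_iff_exists.1 h
  exact ⟨a, ha, a, haP, fun y _ => dvd_mul_right a y⟩

theorem IsLocallyPrincipalAt.of_span {P : Ideal D} [P.IsPrime] {S : Set D} (hS : S.Finite)
    {a : D} (ha : a ∈ S) (h : ∀ b ∈ S, ∃ s ∉ P, a ∣ s * b) :
    IsLocallyPrincipalAt P (Ideal.span S) := by
  have hle : Ideal.span S ≤ primeSaturation P (Ideal.span {a}) := by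
    refine Ideal.span_le.2 fun b hb => ?_
    obtain ⟨s, hs, hab⟩ := h b hb
    exact ⟨s, hs, Ideal.mem_span_singleton.2 hab⟩
  obtain ⟨s, hs, hsy⟩ := exists_forall_mul_mem_of_le_primeSaturation
    (Submodule.fg_def.2 ⟨S, hS, rfl⟩) hle
  exact ⟨a, Ideal.subset_span ha, s, hs, fun y hy => Ideal.mem_span_singleton.1 (hsy y hy)⟩

/-- In a locally principal ideal, one of any given system of generators generates locally. -/
theorem IsLocallyPrincipalAt.exists_generator [IsDomain D] {P : Ideal D} [hP : P.IsPrime]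
    {S : Set D} (hS : Ideal.span S ≠ ⊥) (h : IsLocallyPrincipalAt P (Ideal.span S)) :
    ∃ b ∈ S, ∃ s ∉ P, ∀ y ∈ Ideal.span S, b ∣ s * y := by
  obtain ⟨a, ha, s, hs, hsy⟩ := h
  have ha0 : a ≠ 0 := by
    rintro rfl
    refine hS (eq_bot_iff.2 fun y hy => ?_)
    have h0 : s * y = 0 := zero_dvd_iff.1 (hsy y hy)
    rcases mul_eq_zero.1 h0 with h1 | h1
    · exact (hs (h1 ▸ P.zero_mem)).elim
    · exact h1
  by_contra hcon
  push Not at hcon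
  -- Nakayama by hand: if no member of `S` generates locally, then `s · S ⊆ aP`, so `s a ∈ aP` and
  -- `s ∈ P`.
  have hle : Ideal.span S ≤ (Ideal.span {a} * P).colon {s} := by
    refine Ideal.span_le.2 fun b hb => ?_
    obtain ⟨e, he⟩ := hsy b (Ideal.subset_span hb)
    have heP : e ∈ P := by
      by_contra heP
      obtain ⟨y, hy, hndvd⟩ := hcon b hb (e * s) fun h => (hP.mem_or_mem h).elim heP hs
      obtain ⟨f, hf⟩ := hsy y hy
      refine hndvd ⟨s * f, ?_⟩
      rw [mul_assoc, hf, mul_left_comm, ← mul_assoc, ← he]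
      ring
    refine Submodule.mem_colon_singleton.2 ?_
    rw [smul_eq_mul, mul_comm b s, he]
    exact Ideal.mul_mem_mul (Ideal.mem_span_singleton_self a) heP
  have hsa := Submodule.mem_colon_singleton.1 (hle ha)
  rw [smul_eq_mul] at hsa
  obtain ⟨p, hp, hpa⟩ := Ideal.mem_span_singleton_mul.1 hsa
  exact hs (mul_left_cancel₀ ha0 hpa ▸ hp)

theorem le_and_le_of_disjoint_sup_primeCompl {P Q N : Ideal D} [P.IsPrime] [Q.IsPrime]
    (h : Disjoint (N : Set D) (P.primeCompl ⊔ Q.primeCompl : Submonoid D)) : N ≤ P ∧ N ≤ Q := by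
  constructor
  · intro x hx
    by_contra hxP
    exact Set.disjoint_left.1 h hx ((le_sup_left : P.primeCompl ≤ _) hxP)
  · intro x hx
    by_contra hxP
    exact Set.disjoint_left.1 h hx ((le_sup_right : Q.primeCompl ≤ _) hxP)

/-- Otherwise `A` misses the monoid generated by both complements, and a prime over `A` missing it
is a common nonzero prime of `P` and `Q`. -/
theorem exists_mul_mem_of_no_common_prime {P Q : Ideal D} [P.IsPrime] [Q.IsPrime]
    (h : ¬ ∃ N : Ideal D, N.IsPrime ∧ N ≠ ⊥ ∧ N ≤ P ∧ N ≤ Q) {A : Ideal D} (hA : A ≠ ⊥) :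
    ∃ s ∉ P, ∃ t ∉ Q, s * t ∈ A := by
  by_cases hd : Disjoint (A : Set D) (P.primeCompl ⊔ Q.primeCompl : Submonoid D)
  · obtain ⟨N, hN, hAN, hNd⟩ := Ideal.exists_le_prime_disjoint _ _ hd
    exact (h ⟨N, hN, fun h0 => hA (le_bot_iff.1 (h0 ▸ hAN)), le_and_le_of_disjoint_sup_primeCompl hNd⟩).elim
  · obtain ⟨x, hxA, hx⟩ := Set.not_disjoint_iff.1 hd
    obtain ⟨s, hs, t, ht, rfl⟩ := Submonoid.mem_sup.1 hx
    exact ⟨s, hs, t, ht, hxA⟩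

/-- If `y ∈ P` had no power in `A D_P`, a prime over `A` avoiding `D \ P` and all powers of `y`
would be nonzero and strictly inside `P`. -/
theorem le_radical_primeSaturation {P A : Ideal D} [hP : P.IsPrime]
    (h : ∀ N : Ideal D, N.IsPrime → N ≠ ⊥ → N ≤ P → N = P) (hA : A ≠ ⊥) :
    P ≤ (primeSaturation P A).radical := by
  intro y hy
  by_cases hd : Disjoint (A : Set D) (P.primeCompl ⊔ Submonoid.powers y : Submonoid D)
  · obtain ⟨N, hN, hAN, hNd⟩ := Ideal.exists_le_prime_disjoint _ _ hd
    have hNP : N ≤ P := by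
      intro x hx
      by_contra hxP
      exact Set.disjoint_left.1 hNd hx ((le_sup_left : P.primeCompl ≤ _) hxP)
    have hN0 : N ≠ ⊥ := fun h0 => hA (le_bot_iff.1 (h0 ▸ hAN))
    have hyN : y ∈ N := h N hN hN0 hNP ▸ hy
    exact (Set.disjoint_left.1 hNd hyN
      ((le_sup_right : Submonoid.powers y ≤ _) (Submonoid.mem_powers y))).elim
  · obtain ⟨x, hxA, hx⟩ := Set.not_disjoint_iff.1 hd
    obtain ⟨s, hs, t, ⟨n, rfl⟩, rfl⟩ := Submonoid.mem_sup.1 hx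
    exact ⟨n, s, hs, hxA⟩

theorem mem_heightOnePrimes_iff [IsDomain D] {P : Ideal D} : P ∈ heightOnePrimes D ↔
    P.IsPrime ∧ P ≠ ⊥ ∧ ∀ N : Ideal D, N.IsPrime → N ≠ ⊥ → N ≤ P → N = P := by
  constructor
  · rintro ⟨hP, h⟩
    refine ⟨hP, Ideal.ne_bot_of_height_eq_one h, fun N hN hN0 hNP => ?_⟩
    by_contra hne
    have := (Ideal.height_le_iff (p := P) (n := 1)).1 (by simp [h]) N hN (lt_of_le_of_ne hNP hne)
    rw [Nat.cast_one, Order.lt_one_iff, Ideal.height_eq_zero_iff_eq_bot] at this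
    exact hN0 this
  · rintro ⟨hP, hP0, h⟩
    refine ⟨hP, le_antisymm ?_ ?_⟩
    · refine (Ideal.height_le_iff (p := P) (n := 1)).2 fun N hN hlt => ?_
      rw [Nat.cast_one, Order.lt_one_iff, Ideal.height_eq_zero_iff_eq_bot]
      by_contra hN0
      exact hlt.ne (h N hN hN0 hlt.le)
    · rw [Order.one_le_iff_ne_zero, Ne, Ideal.height_eq_zero_iff_eq_bot]
      exact hP0

theorem algebraMap_dvd_algebraMap_iff (P : Ideal D) [P.IsPrime] [IsDomain D] {a b : D} :
    algebraMap D (Localization.AtPrime P) a ∣ algebraMap D (Localization.AtPrime P) b ↔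
      ∃ s ∉ P, a ∣ s * b := by
  have hinj : Function.Injective (algebraMap D (Localization.AtPrime P)) :=
    IsLocalization.injective _ P.primeCompl_le_nonZeroDivisors
  constructor
  · rintro ⟨c, hc⟩
    obtain ⟨⟨d, s⟩, hd⟩ := IsLocalization.surj P.primeCompl c
    refine ⟨s, s.2, d, hinj ?_⟩
    dsimp only at hd
    rw [map_mul, map_mul, hc, ← hd]
    ring
  · rintro ⟨s, hs, h⟩
    have hu : IsUnit (algebraMap D (Localization.AtPrime P) s) :=
      IsLocalization.map_units _ (⟨s, hs⟩ : P.primeCompl)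
    have := map_dvd (algebraMap D (Localization.AtPrime P)) h
    rwa [map_mul, hu.dvd_mul_left] at this

theorem isAlmostValuationDomain_localization_iff [IsDomain D] (P : Ideal D) [P.IsPrime] :
    IsAlmostValuationDomain (Localization.AtPrime P) ↔ ∀ a b : D, a ≠ 0 → b ≠ 0 →
      ∃ n : ℕ, 0 < n ∧ ((∃ s ∉ P, a ^ n ∣ s * b ^ n) ∨ ∃ s ∉ P, b ^ n ∣ s * a ^ n) := by
  have hinj : Function.Injective (algebraMap D (Localization.AtPrime P)) :=
    IsLocalization.injective _ P.primeCompl_le_nonZeroDivisors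
  simp only [← algebraMap_dvd_algebraMap_iff, map_pow]
  constructor
  · rintro ⟨-, h⟩ a b ha hb
    exact h _ _ (by simpa using hinj.ne ha) (by simpa using hinj.ne hb)
  · intro h
    refine ⟨IsLocalization.isDomain_localization P.primeCompl_le_nonZeroDivisors,
      fun a b ha hb => ?_⟩
    -- Divisibility ignores units, so it suffices to test elements of `D`.
    have key : ∀ c : Localization.AtPrime P, c ≠ 0 →
        ∃ d : D, d ≠ 0 ∧ Associated c (algebraMap D (Localization.AtPrime P) d) := by
      intro c hc
      obtain ⟨⟨d, s⟩, hd⟩ := IsLocalization.surj P.primeCompl c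
      have hs := IsLocalization.map_units (Localization.AtPrime P) s
      refine ⟨d, ?_, hs.unit, hd⟩
      rintro rfl
      rw [map_zero] at hd
      exact hc (hs.mul_left_eq_zero.1 hd)
    obtain ⟨d, hd, hcd⟩ := key a ha
    obtain ⟨e, he, hce⟩ := key b hb
    obtain ⟨n, hn, h1⟩ := h d e hd he
    refine ⟨n, hn, ?_⟩
    have h2 := hcd.pow_pow (n := n)
    have h3 := hce.pow_pow (n := n)
    rwa [h2.dvd_iff_dvd_left, h3.dvd_iff_dvd_right, h3.dvd_iff_dvd_left, h2.dvd_iff_dvd_right]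

end Saturation

/-! ### Maximal `*`-ideals and local tests. -/

namespace StarOperation

open FractionalIdeal

variable {D : Type*} [CommRing D] [IsDomain D]
variable {K : Type*} [Field K] [Algebra D K] [IsFractionRing D K]
variable {star : StarOperation D K}

omit [IsDomain D] in
theorem IsFiniteCharacter.exists_fg (hstar : star.IsFiniteCharacter) {A : Ideal D} {x : D}
    (hx : x ∈ star.idealCl A) : ∃ B : Ideal D, B.FG ∧ B ≤ A ∧ x ∈ star.idealCl B := by
  by_cases hA : A = ⊥
  · subst hA
    exact ⟨⊥, Submodule.fg_bot, le_rfl, hx⟩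
  · obtain ⟨B, -, hBfg, hBA, hxB⟩ := (hstar A (coeIdeal_ne_zero.2 hA) _).1 hx
    obtain ⟨C, rfl⟩ := le_one_iff_exists_coeIdeal.1 (hBA.trans coeIdeal_le_one)
    exact ⟨C, (coeIdeal_fg D⁰ (IsFractionRing.injective D K) C).1 hBfg,
      (coeIdeal_le_coeIdeal K).1 hBA, hxB⟩

variable (star) in
/-- The property of being a nonzero proper `*`-ideal. -/
def IsProperStarIdeal (I : Ideal D) : Prop :=
  I ≠ ⊥ ∧ I ≠ ⊤ ∧ star.idealCl I = I

theorem mem_maxIdeals_iff {P : Ideal D} :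
    P ∈ star.maxIdeals ↔ Maximal star.IsProperStarIdeal P := by
  have : star.IsProperStarIdeal = fun I : Ideal D => I ≠ ⊥ ∧ I ≠ ⊤ ∧
      star.cl (I : FractionalIdeal D⁰ K) = (I : FractionalIdeal D⁰ K) := by
    ext I
    rw [IsProperStarIdeal, idealCl_eq_self_iff]
  rw [this]
  rfl

theorem ne_bot_of_mem_maxIdeals {P : Ideal D} (hP : P ∈ star.maxIdeals) : P ≠ ⊥ :=
  (mem_maxIdeals_iff.1 hP).1.1

theorem idealCl_of_mem_maxIdeals {P : Ideal D} (hP : P ∈ star.maxIdeals) :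
    star.idealCl P = P :=
  (mem_maxIdeals_iff.1 hP).1.2.2

theorem idealCl_le_of_mem_maxIdeals {P A : Ideal D} (hP : P ∈ star.maxIdeals) (h : A ≤ P) :
    star.idealCl A ≤ P :=
  (star.idealCl_mono h).trans (idealCl_of_mem_maxIdeals hP).le

/-- If `a ∉ P`, maximality gives `(P + aD)_* = D`. Multiplying by `b` yields `bD = (bP + abD)_*`,
which lies in `P` when `ab ∈ P`. -/
theorem isPrime_of_mem_maxIdeals {P : Ideal D} (hP : P ∈ star.maxIdeals) : P.IsPrime := by
  have hmax := mem_maxIdeals_iff.1 hP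
  refine ⟨hmax.1.2.1, fun {a b} hab => or_iff_not_imp_left.2 fun ha => ?_⟩
  have htop : star.idealCl (P ⊔ Ideal.span {a}) = ⊤ := by
    by_contra hne
    have hle : P ≤ star.idealCl (P ⊔ Ideal.span {a}) := le_sup_left.trans (star.le_idealCl _)
    have hge := hmax.2 ⟨fun h0 => hmax.1.1 (le_bot_iff.1 (h0 ▸ hle)), hne,
      star.idealCl_idealCl _⟩ hle
    exact ha (hge (star.le_idealCl _ (Ideal.mem_sup_right (Ideal.mem_span_singleton_self a))))
  have h1 := star.idealCl_span_singleton_mul b (P ⊔ Ideal.span {a})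
  rw [htop, Ideal.mul_top] at h1
  refine idealCl_le_of_mem_maxIdeals hP (A := Ideal.span {b} * (P ⊔ Ideal.span {a})) ?_
    (h1.symm ▸ Ideal.mem_span_singleton_self b)
  rw [Ideal.mul_sup, Ideal.span_singleton_mul_span_singleton]
  refine sup_le Ideal.mul_le_right ((Ideal.span_singleton_le_iff_mem _).2 ?_)
  rwa [mul_comm]

/-- Zorn's lemma applies because finite character makes the union of a chain of proper `*`-ideals
again one. -/
theorem IsFiniteCharacter.exists_le_maxIdeal (hstar : star.IsFiniteCharacter) {A : Ideal D}
    (hA : A ≠ ⊥) (hA' : star.idealCl A ≠ ⊤) : ∃ P ∈ star.maxIdeals, A ≤ P := by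
  have hcl : star.IsProperStarIdeal (star.idealCl A) :=
    ⟨fun h0 => hA (le_bot_iff.1 (h0 ▸ star.le_idealCl A)), hA', star.idealCl_idealCl A⟩
  obtain ⟨P, hAP, hP⟩ := zorn_le_nonempty₀ {I : Ideal D | star.IsProperStarIdeal I}
    (fun c hc hchain J hJ => by
      have hdir : DirectedOn (· ≤ ·) c := hchain.directedOn
      have hfg : ∀ B : Ideal D, B.FG → B ≤ sSup c → ∃ I ∈ c, B ≤ I := fun B hB hBc =>
        (CompleteLattice.isCompactElement_iff_le_of_directed_sSup_le _ _).1
          ((Submodule.fg_iff_compact B).1 hB) c ⟨J, hJ⟩ hdir hBc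
      refine ⟨sSup c, ⟨fun h0 => (hc hJ).1 (le_bot_iff.1 (h0 ▸ le_sSup hJ)), fun htop => ?_,
        le_antisymm (fun x hx => ?_) (star.le_idealCl _)⟩, fun I hI => le_sSup hI⟩
      · obtain ⟨I, hI, hle⟩ := hfg ⊤ (Ideal.fg_top D) htop.ge
        exact (hc hI).2.1 (top_le_iff.1 hle)
      · obtain ⟨B, hB, hBc, hxB⟩ := hstar.exists_fg hx
        obtain ⟨I, hI, hle⟩ := hfg B hB hBc
        exact le_sSup hI ((hc hI).2.2 ▸ star.idealCl_mono hle hxB)) _ hcl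
  exact ⟨P, mem_maxIdeals_iff.2 hP, (star.le_idealCl A).trans hAP⟩

/-- `⋂ A D_P ⊆ A_*`, the intersection being over the maximal `*`-ideals `P`. -/
theorem IsFiniteCharacter.mem_idealCl (hstar : star.IsFiniteCharacter) {A : Ideal D}
    (hA : A ≠ ⊥) {y : D} (h : ∀ P ∈ star.maxIdeals, ∃ s ∉ P, s * y ∈ A) :
    y ∈ star.idealCl A := by
  have hle : A ≤ A.colon {y} := fun a ha =>
    Submodule.mem_colon_singleton.2 (Ideal.mul_mem_right y A ha)
  -- The hypothesis says that `(A : y)` lies in no maximal `*`-ideal; multiply its closure, `D`, by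
  -- `y`.
  have htop : star.idealCl (A.colon {y}) = ⊤ := by
    by_contra hne
    obtain ⟨P, hP, hJP⟩ := hstar.exists_le_maxIdeal
      (fun h0 => hA (le_bot_iff.1 (h0 ▸ hle))) hne
    obtain ⟨s, hs, hsy⟩ := h P hP
    exact hs (hJP (Submodule.mem_colon_singleton.2 hsy))
  have h1 := star.idealCl_span_singleton_mul y (A.colon {y})
  rw [htop, Ideal.mul_top] at h1
  refine star.idealCl_mono ?_ (h1.symm ▸ Ideal.mem_span_singleton_self y)
  refine Ideal.mul_le.2 fun u hu v hv => ?_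
  obtain ⟨c, rfl⟩ := Ideal.mem_span_singleton'.1 hu
  rw [mul_assoc, mul_comm y v]
  exact A.mul_mem_left c (Submodule.mem_colon_singleton.1 hv)

/-- With `(AB)_* = dD`, not all products `ab` lie in the `*`-ideal `dP`. If `ab = ds` with `s ∉ P`,
then `a` generates even `A_*` at `P`, with denominator `s`. -/
theorem IsInvertible.exists_generator {A : Ideal D}
    (hA : star.IsInvertible (A : FractionalIdeal D⁰ K)) {P : Ideal D}
    (hP : P ∈ star.maxIdeals) : ∃ a ∈ A, ∃ s ∉ P, ∀ y ∈ star.idealCl A, a ∣ s * y := by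
  have hPprime := isPrime_of_mem_maxIdeals hP
  obtain ⟨B, d, hd, h⟩ := star.isInvertible_coeIdeal_iff.1 hA
  have hnle : ¬ A * B ≤ Ideal.span {d} * P := by
    intro hle
    have := star.idealCl_mono hle
    rw [star.idealCl_span_singleton_mul, idealCl_of_mem_maxIdeals hP, h] at this
    obtain ⟨p, hp, hpd⟩ := Ideal.mem_span_singleton_mul.1 (this (Ideal.mem_span_singleton_self d))
    rw [mul_eq_left₀ hd] at hpd
    exact P.one_notMem (hpd ▸ hp)
  rw [Ideal.mul_le] at hnle
  push Not at hnle
  obtain ⟨a, ha, b, hb, hab⟩ := hnle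
  have hmem : a * b ∈ Ideal.span {d} := h ▸ star.le_idealCl _ (Ideal.mul_mem_mul ha hb)
  obtain ⟨s, hs⟩ := Ideal.mem_span_singleton.1 hmem
  refine ⟨a, ha, s, fun hsP => hab (Ideal.mem_span_singleton_mul.2 ⟨s, hsP, hs.symm⟩),
    fun y hy => ?_⟩
  have hyb : y * b ∈ Ideal.span {d} := by
    rw [← h, ← idealCl_idealCl_mul]
    exact star.le_idealCl _ (Ideal.mul_mem_mul hy hb)
  obtain ⟨e, he⟩ := Ideal.mem_span_singleton.1 hyb
  refine ⟨e, mul_left_cancel₀ hd ?_⟩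
  calc d * (s * y) = (d * s) * y := by ring
    _ = a * (y * b) := by rw [← hs]; ring
    _ = d * (a * e) := by rw [he]; ring

theorem IsInvertible.isLocallyPrincipalAt {A : Ideal D}
    (hA : star.IsInvertible (A : FractionalIdeal D⁰ K)) {P : Ideal D}
    (hP : P ∈ star.maxIdeals) : IsLocallyPrincipalAt P A := by
  obtain ⟨a, ha, s, hs, h⟩ := hA.exists_generator hP
  exact ⟨a, ha, s, hs, fun y hy => h y (star.le_idealCl A hy)⟩

theorem IsFiniteCharacter.isInvertible (hstar : star.IsFiniteCharacter) {A : Ideal D}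
    (hA : A ≠ ⊥) (h : ∀ P ∈ star.maxIdeals, IsLocallyPrincipalAt P A) :
    star.IsInvertible (A : FractionalIdeal D⁰ K) := by
  obtain ⟨x, hxA, hx⟩ := Submodule.exists_mem_ne_zero_of_ne_bot hA
  -- `B` is `x A⁻¹` in integral form; `(AB)_* = xD` is checked locally, with the cofactor `e` in `s
  -- x = a e` lying in `B`.
  set B : Ideal D := (Ideal.span {x}).colon (A : Set D) with hB
  have hxB : x ∈ B := Submodule.mem_colon.2 fun y _ =>
    Ideal.mul_mem_right y _ (Ideal.mem_span_singleton_self x)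
  refine star.isInvertible_coeIdeal_iff.2 ⟨B, x, hx, le_antisymm ?_ ?_⟩
  · rw [← star.idealCl_span_singleton x]
    refine star.idealCl_mono (Ideal.mul_le.2 fun a ha b hb => ?_)
    rw [mul_comm]
    exact Submodule.mem_colon.1 hb a ha
  · refine (Ideal.span_singleton_le_iff_mem _).2 (hstar.mem_idealCl ?_ fun P hP => ?_)
    · intro h0
      have := Ideal.mul_mem_mul hxA hxB
      rw [h0, Ideal.mem_bot] at this
      exact hx (mul_self_eq_zero.1 this)
    · obtain ⟨a, ha, s, hs, hsy⟩ := h P hP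
      obtain ⟨e, he⟩ := hsy x hxA
      have ha0 : a ≠ 0 := by
        rintro rfl
        rw [zero_mul] at he
        rcases mul_eq_zero.1 he with h1 | h1
        · exact hs (h1 ▸ P.zero_mem)
        · exact hx h1
      refine ⟨s, hs, he ▸ Ideal.mul_mem_mul ha (Submodule.mem_colon.2 fun y hy => ?_)⟩
      obtain ⟨f, hf⟩ := hsy y hy
      refine Ideal.mem_span_singleton.2 ⟨f, mul_left_cancel₀ ha0 ?_⟩
      calc a * (e * y) = s * x * y := by rw [he]; ring
        _ = x * (s * y) := by ring
        _ = a * (x * f) := by rw [hf]; ring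

theorem IsInvertible.of_idealCl_eq {A B : Ideal D}
    (hA : star.IsInvertible (A : FractionalIdeal D⁰ K)) (h : star.idealCl A = star.idealCl B) :
    star.IsInvertible (B : FractionalIdeal D⁰ K) := by
  obtain ⟨C, d, hd, hC⟩ := star.isInvertible_coeIdeal_iff.1 hA
  exact star.isInvertible_coeIdeal_iff.2 ⟨C, d, hd, by
    rw [← hC, ← idealCl_idealCl_mul, ← h, idealCl_idealCl_mul]⟩

/-- The closure of a power of a `*`-invertible ideal is the closure of the ideal generated by
the powers of the generators. -/
theorem IsFiniteCharacter.idealCl_span_pow (hstar : star.IsFiniteCharacter) {S : Set D}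
    (hS : star.IsInvertible ((Ideal.span S : Ideal D) : FractionalIdeal D⁰ K)) (n : ℕ) :
    star.idealCl (Ideal.span S ^ n) = star.idealCl (Ideal.span ((· ^ n) '' S)) := by
  apply le_antisymm
  · refine star.idealCl_le_iff.2 fun y hy => hstar.mem_idealCl ?_ fun P hP => ?_
    · intro h0
      refine hS.ne_bot (Ideal.span_eq_bot.2 fun x hx => ?_)
      exact eq_zero_of_pow_eq_zero (Ideal.span_eq_bot.1 h0 _ ⟨x, hx, rfl⟩)
    · have hPprime := isPrime_of_mem_maxIdeals hP
      obtain ⟨b, hb, s, hs, hsy⟩ :=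
        (hS.isLocallyPrincipalAt hP).exists_generator hS.ne_bot
      refine ⟨s ^ n, fun h => hs (hPprime.mem_of_pow_mem n h), ?_⟩
      -- Raising this to the `n`-th power shows that `bⁿ` generates the `n`-th power at `P`, with
      -- denominator `sⁿ`.
      have hle : Ideal.span {s} * Ideal.span S ≤ Ideal.span {b} := by
        refine Ideal.mul_le.2 fun u hu v hv => ?_
        obtain ⟨c, rfl⟩ := Ideal.mem_span_singleton'.1 hu
        rw [mul_assoc]
        exact Ideal.mul_mem_left _ c (Ideal.mem_span_singleton.2 (hsy v hv))
      have hle' := Ideal.pow_right_mono hle n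
      rw [mul_pow, Ideal.span_singleton_pow, Ideal.span_singleton_pow] at hle'
      have hmem := hle' (Ideal.mul_mem_mul (Ideal.mem_span_singleton_self _) hy)
      exact (Ideal.span_singleton_le_iff_mem _).2
        (Ideal.subset_span (Set.mem_image_of_mem (· ^ n) hb)) hmem
  · refine star.idealCl_mono (Ideal.span_le.2 ?_)
    rintro _ ⟨b, hb, rfl⟩
    exact Ideal.pow_mem_pow (Ideal.subset_span hb) n

/-! ### Homogeneous components in a `*`-h-local domain. -/

omit [IsDomain D] in
theorem primeSaturation_le {P A : Ideal D} [hP : P.IsPrime] (h : A ≤ P) :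
    primeSaturation P A ≤ P :=
  fun _ ⟨_, hs, hsy⟩ => (hP.mem_or_mem (h hsy)).resolve_left hs

omit [IsDomain D] in
theorem finite_setOf_le {F : Set (Ideal D)} (hF : IsLocallyFiniteFamily F)
    (hF' : ∀ P ∈ F, P ≠ ⊤) {A : Ideal D} (hA : A ≠ ⊥) : {P ∈ F | A ≤ P}.Finite := by
  obtain ⟨x, hxA, hx⟩ := Submodule.exists_mem_ne_zero_of_ne_bot hA
  by_cases hu : IsUnit x
  · convert Set.finite_empty
    ext P
    simp only [Set.mem_ofPred_eq, Set.mem_empty_iff_false, iff_false, not_and]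
    exact fun hP hAP => hF' P hP (Ideal.eq_top_of_isUnit_mem P (hAP hxA) hu)
  · exact (hF x hx hu).subset fun P hP => ⟨hP.1, hP.2 hxA⟩

/-- In a `*`-h-local domain the `P`-component of a `*`-invertible finitely generated ideal. -/
theorem IsHLocal.exists_component (hloc : star.IsHLocal) (hstar : star.IsFiniteCharacter)
    {A : Ideal D} (hfg : A.FG) (hA : star.IsInvertible (A : FractionalIdeal D⁰ K))
    {P : Ideal D} (hP : P ∈ star.maxIdeals) (hAP : A ≤ P) :
    ∃ B : Ideal D, A ≤ B ∧ (∃ t ∉ P, ∀ y ∈ B, t * y ∈ A) ∧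
      star.IsInvertible (B : FractionalIdeal D⁰ K) ∧ star.IsHomogeneousAt P B := by
  have hPprime := isPrime_of_mem_maxIdeals hP
  have hfin : {Q ∈ star.maxIdeals | A ≤ Q}.Finite :=
    finite_setOf_le hloc.2.2 (fun Q hQ => (isPrime_of_mem_maxIdeals hQ).ne_top) hA.ne_bot
  -- Independence supplies `t ∉ Q` in `A D_P ∩ D`; adjoining it to `A` excludes `Q` and changes
  -- nothing at `P`.
  have hex : ∀ Q : Ideal D, ∃ t : D, Q ∈ star.maxIdeals → Q ≠ P →
      t ∉ Q ∧ t ∈ primeSaturation P A := by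
    intro Q
    by_cases hQ : Q ∈ star.maxIdeals ∧ Q ≠ P
    · have hQprime := isPrime_of_mem_maxIdeals hQ.1
      obtain ⟨s, hs, t, ht, hst⟩ :=
        exists_mul_mem_of_no_common_prime (hloc.2.1 P hP Q hQ.1 hQ.2.symm) hA.ne_bot
      exact ⟨t, fun _ _ => ⟨ht, s, hs, hst⟩⟩
    · exact ⟨0, fun h1 h2 => (hQ ⟨h1, h2⟩).elim⟩
  choose t ht using hex
  set T : Set D := t '' ({Q ∈ star.maxIdeals | A ≤ Q} \ {P}) with hT
  have hTfin : T.Finite := (hfin.sdiff).image t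
  set B : Ideal D := A ⊔ Ideal.span T with hB
  have hAB : A ≤ B := le_sup_left
  have hBfg : B.FG := Submodule.FG.sup hfg (Submodule.fg_def.2 ⟨T, hTfin, rfl⟩)
  have hBsat : B ≤ primeSaturation P A := by
    refine sup_le (le_primeSaturation P A) (Ideal.span_le.2 ?_)
    rintro _ ⟨Q, ⟨⟨hQ, -⟩, hQP⟩, rfl⟩
    exact (ht Q hQ hQP).2
  obtain ⟨u, hu, huB⟩ := exists_forall_mul_mem_of_le_primeSaturation hBfg hBsat
  have hB0 : B ≠ ⊥ := fun h0 => hA.ne_bot (le_bot_iff.1 (h0 ▸ hAB))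
  have hhom : ∀ Q ∈ star.maxIdeals, B ≤ Q → Q = P := by
    intro Q hQ hBQ
    by_contra hQP
    refine (ht Q hQ hQP).1 (hBQ (Ideal.mem_sup_right (Ideal.subset_span ?_)))
    exact ⟨Q, ⟨⟨hQ, hAB.trans hBQ⟩, hQP⟩, rfl⟩
  refine ⟨B, hAB, ⟨u, hu, huB⟩, hstar.isInvertible hB0 fun Q hQ => ?_,
    hB0, hBfg, hP, hBsat.trans (primeSaturation_le hAP), hhom⟩
  by_cases hBQ : B ≤ Q
  · obtain rfl := hhom Q hQ hBQ
    obtain ⟨a, ha, s, hs, hsy⟩ := hA.isLocallyPrincipalAt hQ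
    refine ⟨a, hAB ha, s * u, fun h => (hPprime.mem_or_mem h).elim hs hu, fun y hy => ?_⟩
    rw [mul_assoc]
    exact hsy _ (huB y hy)
  · exact .of_not_le hBQ

/-- Take the product of the components at the finitely many maximal `*`-ideals over `A`. At each of
them its own component agrees with `A`, and the others become trivial. -/
theorem IsHLocal.exists_list_isHomogeneous (hloc : star.IsHLocal)
    (hstar : star.IsFiniteCharacter) {A : Ideal D} (hfg : A.FG)
    (hA : star.IsInvertible (A : FractionalIdeal D⁰ K)) :
    ∃ l : List (Ideal D), (∀ B ∈ l, star.IsInvertible (B : FractionalIdeal D⁰ K) ∧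
      star.IsHomogeneous B) ∧ star.idealCl A = star.idealCl l.prod := by
  have hfin : {Q ∈ star.maxIdeals | A ≤ Q}.Finite :=
    finite_setOf_le hloc.2.2 (fun Q hQ => (isPrime_of_mem_maxIdeals hQ).ne_top) hA.ne_bot
  have hex : ∀ P : Ideal D, ∃ B : Ideal D, P ∈ star.maxIdeals → A ≤ P →
      A ≤ B ∧ (∃ t ∉ P, ∀ y ∈ B, t * y ∈ A) ∧
      star.IsInvertible (B : FractionalIdeal D⁰ K) ∧ star.IsHomogeneousAt P B := by
    intro P
    by_cases hP : P ∈ star.maxIdeals ∧ A ≤ P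
    · obtain ⟨B, hB⟩ := hloc.exists_component hstar hfg hA hP.1 hP.2
      exact ⟨B, fun _ _ => hB⟩
    · exact ⟨⊥, fun h1 h2 => (hP ⟨h1, h2⟩).elim⟩
  choose B hB using hex
  classical
  set F : Finset (Ideal D) := hfin.toFinset with hF
  have hmemF : ∀ P, P ∈ F ↔ P ∈ star.maxIdeals ∧ A ≤ P := fun P => by
    rw [hF, Set.Finite.mem_toFinset]
    rfl
  have hBF : ∀ P ∈ F, A ≤ B P ∧ (∃ t ∉ P, ∀ y ∈ B P, t * y ∈ A) ∧
      star.IsInvertible (B P : FractionalIdeal D⁰ K) ∧ star.IsHomogeneousAt P (B P) :=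
    fun P hP => hB P ((hmemF P).1 hP).1 ((hmemF P).1 hP).2
  have hnot : ∀ Q ∈ star.maxIdeals, ∀ G ⊆ F, Q ∉ G → ∃ s ∈ ∏ P ∈ G, B P, s ∉ Q := by
    intro Q hQ G hG hQG
    refine SetLike.not_le_iff_exists.1 fun hle => ?_
    obtain ⟨P, hPG, hPQ⟩ := ((isPrime_of_mem_maxIdeals hQ).prod_le).1 hle
    exact hQG ((hBF P (hG hPG)).2.2.2.2.2.2.2 Q hQ hPQ ▸ hPG)
  refine ⟨F.toList.map B, fun C hC => ?_, ?_⟩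
  · obtain ⟨P, hP, rfl⟩ := List.mem_map.1 hC
    have := hBF P (Finset.mem_toList.1 hP)
    exact ⟨this.2.2.1, P, this.2.2.2⟩
  rw [Finset.prod_map_toList]
  apply le_antisymm
  · refine star.idealCl_le_iff.2 fun y hy => hstar.mem_idealCl ?_ fun Q hQ => ?_
    · rw [← Ideal.zero_eq_bot, Finset.prod_ne_zero_iff]
      exact fun P hP => (hBF P hP).2.2.1.ne_bot
    · by_cases hQF : Q ∈ F
      · obtain ⟨s, hs, hsQ⟩ := hnot Q hQ (F.erase Q) (Finset.erase_subset _ _)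
          (Finset.notMem_erase _ _)
        refine ⟨s, hsQ, ?_⟩
        rw [← Finset.prod_erase_mul F B hQF]
        exact Ideal.mul_mem_mul hs ((hBF Q hQF).1 hy)
      · obtain ⟨s, hs, hsQ⟩ := hnot Q hQ F subset_rfl hQF
        exact ⟨s, hsQ, Ideal.mul_mem_right y _ hs⟩
  · refine star.idealCl_le_iff.2 fun y hy => hstar.mem_idealCl hA.ne_bot fun Q hQ => ?_
    by_cases hQF : Q ∈ F
    · obtain ⟨t, ht, htB⟩ := (hBF Q hQF).2.1
      have hle : ∏ P ∈ F, B P ≤ B Q := Ideal.prod_le_inf.trans (Finset.inf_le hQF)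
      exact ⟨t, ht, htB y (hle hy)⟩
    · have : ¬ A ≤ Q := fun h => hQF ((hmemF Q).2 ⟨hQ, h⟩)
      obtain ⟨s, hs, hsQ⟩ := SetLike.not_le_iff_exists.1 this
      exact ⟨s, hsQ, Ideal.mul_mem_right y _ hs⟩

theorem IsHomogeneousAt.eq_radical (hstar : star.IsFiniteCharacter) {P A : Ideal D}
    (hA : star.IsHomogeneousAt P A)
    (h : ∀ N : Ideal D, N.IsPrime → N ≠ ⊥ → N ≤ P → N = P) :
    P = (star.idealCl A).radical := by
  obtain ⟨hA0, -, hP, hAP, huniq⟩ := hA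
  have hPprime := isPrime_of_mem_maxIdeals hP
  apply le_antisymm
  · intro y hy
    obtain ⟨n, hn⟩ := le_radical_primeSaturation h hA0 hy
    refine ⟨n, hstar.mem_idealCl hA0 fun Q hQ => ?_⟩
    by_cases hAQ : A ≤ Q
    · obtain rfl := huniq Q hQ hAQ
      exact hn
    · obtain ⟨s, hs, hsQ⟩ := SetLike.not_le_iff_exists.1 hAQ
      exact ⟨s, hsQ, Ideal.mul_mem_right _ _ hs⟩
  · exact hPprime.radical_le_iff.2 (idealCl_le_of_mem_maxIdeals hP hAP)

/-- A fraction `a / b` in every `D_P` has `a ∈ (bD)_* = bD`. -/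
theorem IsFiniteCharacter.isDefiningFamily_maxIdeals (hstar : star.IsFiniteCharacter) :
    IsDefiningFamily K star.maxIdeals := by
  refine ⟨fun P hP => isPrime_of_mem_maxIdeals hP, subset_antisymm (fun z hz => ?_) ?_⟩
  · obtain ⟨a, b, hb, rfl⟩ := IsFractionRing.div_surjective (A := D) z
    have hb0 : b ≠ 0 := nonZeroDivisors.ne_zero hb
    have hb' : algebraMap D K b ≠ 0 := by simpa using hb0
    have hab : a ∈ star.idealCl (Ideal.span {b}) := by
      refine hstar.mem_idealCl (by simpa using hb0) fun P hP => ?_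
      obtain ⟨c, s, hs, hc⟩ := Set.mem_iInter₂.1 hz P hP
      have hs' : algebraMap D K s ≠ 0 := by
        have : s ≠ 0 := fun h => hs (h ▸ P.zero_mem)
        simpa using this
      rw [div_eq_div_iff hb' hs', ← map_mul, ← map_mul] at hc
      refine ⟨s, hs, Ideal.mem_span_singleton.2 ⟨c, ?_⟩⟩
      have := IsFractionRing.injective D K hc
      rw [mul_comm s, this, mul_comm]
    rw [idealCl_span_singleton] at hab
    obtain ⟨c, rfl⟩ := Ideal.mem_span_singleton.1 hab
    exact ⟨c, by rw [map_mul, mul_div_cancel_left₀ _ hb']⟩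
  · rintro _ ⟨c, rfl⟩
    refine Set.mem_iInter₂.2 fun P hP => ⟨c, 1, ?_, by simp⟩
    have := isPrime_of_mem_maxIdeals hP
    exact P.one_notMem

omit [IsDomain D] in
theorem IsHomogeneousAt.eq {P Q A : Ideal D} (hP : star.IsHomogeneousAt P A)
    (hQ : star.IsHomogeneousAt Q A) : Q = P :=
  hP.2.2.2.2 Q hQ.2.2.1 hQ.2.2.2.1

/-- Uniqueness of `M(A)` merges the two witnesses in the definition; finite sets replace tuples. -/
theorem isTypeOneAfgHomogeneous_iff {A : Ideal D} : star.IsTypeOneAfgHomogeneous A ↔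
    star.IsInvertible (A : FractionalIdeal D⁰ K) ∧ ∃ P : Ideal D, star.IsHomogeneousAt P A ∧
      P = (star.idealCl A).radical ∧ ∀ S : Set D, S.Finite → S ⊆ P →
        (∃ r : ℕ, 0 < r ∧ A ^ r ≤ star.idealCl (Ideal.span S)) →
        ∃ n : ℕ, 0 < n ∧ ∃ d : D, star.idealCl (Ideal.span ((· ^ n) '' S)) = Ideal.span {d} := by
  simp only [IsTypeOneAfgHomogeneous, IsAfgHomogeneous, IsTypeOneHomogeneous,
    le_cl_coeIdeal_iff, isPrincipalFractional_cl_iff]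
  constructor
  · rintro ⟨⟨hinv, P, hP, h⟩, Q, hQ, hrad⟩
    obtain rfl := hP.eq hQ
    refine ⟨hinv, Q, hQ, hrad, fun S hS hSP hr => ?_⟩
    obtain ⟨s, b, -, rfl⟩ := hS.fin_param
    obtain ⟨n, hn, hd⟩ := h s b (fun i => hSP ⟨i, rfl⟩) hr
    refine ⟨n, hn, ?_⟩
    rwa [← Set.range_comp]
  · rintro ⟨hinv, P, hP, hrad, h⟩
    refine ⟨⟨hinv, P, hP, fun s b hb hr => ?_⟩, P, hP, hrad⟩
    obtain ⟨n, hn, hd⟩ := h _ (Set.finite_range b) (Set.range_subset_iff.2 hb) hr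
    refine ⟨n, hn, ?_⟩
    rwa [← Set.range_comp] at hd

omit [IsDomain D] in
theorem exists_pow_le_primeSaturation {P A C : Ideal D} [hP : P.IsPrime]
    (h : ∀ N : Ideal D, N.IsPrime → N ≠ ⊥ → N ≤ P → N = P) (hA : A ≠ ⊥) (hC : C.FG)
    (hCP : C ≤ P) : ∃ m : ℕ, 0 < m ∧ C ^ m ≤ primeSaturation P A := by
  obtain ⟨m, hm⟩ := Ideal.exists_pow_le_of_le_radical_of_fg
    (hCP.trans (le_radical_primeSaturation h hA)) hC
  -- The shift by one keeps the exponent positive, as the afg condition requires.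
  exact ⟨m + 1, m.succ_pos, (Ideal.pow_le_pow_right m.le_succ).trans hm⟩

/-! ### Structure of type 1 `*`-afg-SH domains. -/

namespace IsTypeOneAfgSHDomain

theorem exists_list (h : star.IsTypeOneAfgSHDomain) {x : D} (hx : x ≠ 0)
    {Q : Ideal D} (hQ : Q.IsPrime) (hxQ : x ∈ Q) :
    ∃ l : List (Ideal D), (∀ B ∈ l, star.IsTypeOneAfgHomogeneous B) ∧
      l.prod ≤ Ideal.span {x} := by
  have hu : ¬ IsUnit x := fun hu => hQ.ne_top (Ideal.eq_top_of_isUnit_mem Q hxQ hu)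
  obtain ⟨l, hl, heq⟩ := star.isStarProductOf_iff.1 (h x hx hu)
  rw [idealCl_span_singleton] at heq
  exact ⟨l, hl, heq ▸ star.le_idealCl _⟩

omit [IsDomain D] in
theorem exists_mem_le {l : List (Ideal D)} {Q : Ideal D} (hQ : Q.IsPrime) (h : l.prod ≤ Q) :
    ∃ B ∈ l, B ≤ Q := by
  have := (hQ.multiset_prod_le (s := (l : Multiset (Ideal D)))).1 (by simpa using h)
  simpa using this

theorem exists_le (h : star.IsTypeOneAfgSHDomain) {Q : Ideal D} (hQ : Q.IsPrime) (hQ0 : Q ≠ ⊥) :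
    ∃ C : Ideal D, star.IsTypeOneAfgHomogeneous C ∧ C ≤ Q := by
  obtain ⟨x, hxQ, hx⟩ := Submodule.exists_mem_ne_zero_of_ne_bot hQ0
  obtain ⟨l, hl, hle⟩ := h.exists_list hx hQ hxQ
  obtain ⟨C, hC, hCQ⟩ := exists_mem_le hQ (hle.trans ((Ideal.span_singleton_le_iff_mem _).2 hxQ))
  exact ⟨C, hl C hC, hCQ⟩

/-- A type 1 factor `C ⊆ N` has `√(C_*) = P`. Since an element of `C` generates `C_*` at `P`, `C_* ⊆
N` as well, so `P ⊆ N`. -/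
theorem eq_of_le (h : star.IsTypeOneAfgSHDomain) {P : Ideal D} (hP : P ∈ star.maxIdeals)
    {N : Ideal D} (hN : N.IsPrime) (hN0 : N ≠ ⊥) (hNP : N ≤ P) : N = P := by
  obtain ⟨C, hC, hCN⟩ := h.exists_le hN hN0
  obtain ⟨hinv, Q, hQ, hrad, -⟩ := isTypeOneAfgHomogeneous_iff.1 hC
  obtain rfl := hQ.2.2.2.2 P hP (hCN.trans hNP)
  refine le_antisymm hNP ?_
  rw [hrad]
  refine hN.radical_le_iff.2 fun y hy => ?_
  obtain ⟨a, ha, s, hs, hsy⟩ := hinv.exists_generator hP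
  have : s * y ∈ N := hCN (Ideal.mem_of_dvd C (hsy y hy) ha)
  exact (hN.mem_or_mem this).resolve_left fun hsN => hs (hNP hsN)

theorem isLocallyFiniteFamily (h : star.IsTypeOneAfgSHDomain) :
    IsLocallyFiniteFamily star.maxIdeals := by
  intro x hx hu
  obtain ⟨l, hl, heq⟩ := star.isStarProductOf_iff.1 (h x hx hu)
  rw [idealCl_span_singleton] at heq
  have hle : l.prod ≤ Ideal.span {x} := heq ▸ star.le_idealCl _
  refine (l.finite_toSet.biUnion (t := fun B => {P ∈ star.maxIdeals | B ≤ P})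
    fun B hB => ?_).subset fun P hP => ?_
  · obtain ⟨-, Q, hQ, -⟩ := isTypeOneAfgHomogeneous_iff.1 (hl B hB)
    exact (Set.finite_singleton Q).subset fun P hP => hQ.2.2.2.2 P hP.1 hP.2
  · obtain ⟨B, hB, hBP⟩ := exists_mem_le (isPrime_of_mem_maxIdeals hP.1)
      (hle.trans ((Ideal.span_singleton_le_iff_mem _).2 hP.2))
    exact Set.mem_biUnion hB ⟨hP.1, hBP⟩

theorem maxIdeals_eq (h : star.IsTypeOneAfgSHDomain) (hstar : star.IsFiniteCharacter) :
    star.maxIdeals = heightOnePrimes D := by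
  ext Q
  rw [mem_heightOnePrimes_iff]
  refine ⟨fun hQ => ⟨isPrime_of_mem_maxIdeals hQ, ne_bot_of_mem_maxIdeals hQ,
    fun N hN hN0 hNQ => h.eq_of_le hQ hN hN0 hNQ⟩, ?_⟩
  rintro ⟨hQ, hQ0, hmin⟩
  -- Otherwise a finitely generated `B ⊆ Q` has `B_* = D`. Minimality of `Q` gives `s Bᵐ ⊆ xD` with
  -- `s ∉ Q`, and taking closures puts `s` in `xD ⊆ Q`.
  have hcl : star.idealCl Q ≠ ⊤ := by
    intro htop
    obtain ⟨B, hBfg, hBQ, hB⟩ := hstar.exists_fg (x := 1) (htop ▸ Submodule.mem_top)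
    rw [← Ideal.eq_top_iff_one] at hB
    obtain ⟨x, hxQ, hx⟩ := Submodule.exists_mem_ne_zero_of_ne_bot hQ0
    obtain ⟨m, -, hm⟩ := exists_pow_le_primeSaturation hmin
      (A := Ideal.span {x}) (by simpa using hx) hBfg hBQ
    obtain ⟨s, hs, hsB⟩ := exists_forall_mul_mem_of_le_primeSaturation
      (Submodule.FG.pow hBfg m) hm
    have hpow : star.idealCl (B ^ m) = ⊤ := by
      rw [← idealCl_pow_idealCl, hB, Ideal.top_pow, idealCl_top]
    have hle : Ideal.span {s} * B ^ m ≤ Ideal.span {x} := by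
      refine Ideal.mul_le.2 fun u hu v hv => ?_
      obtain ⟨c, rfl⟩ := Ideal.mem_span_singleton'.1 hu
      rw [mul_assoc]
      exact Ideal.mul_mem_left _ c (hsB v hv)
    have hle' := star.idealCl_mono hle
    rw [idealCl_span_singleton_mul, hpow, Ideal.mul_top, idealCl_span_singleton] at hle'
    exact hs ((Ideal.span_singleton_le_iff_mem _).2 hxQ
      (hle' (Ideal.mem_span_singleton_self s)))
  obtain ⟨P, hP, hQP⟩ := hstar.exists_le_maxIdeal hQ0 hcl
  rwa [h.eq_of_le hP hQ hQ0 hQP]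

theorem isAlmostValuationDomain (h : star.IsTypeOneAfgSHDomain) {P : Ideal D} [hPp : P.IsPrime]
    (hP : P ∈ star.maxIdeals) : IsAlmostValuationDomain (Localization.AtPrime P) := by
  rw [isAlmostValuationDomain_localization_iff]
  intro a b ha hb
  by_cases haP : a ∈ P
  swap
  · exact ⟨1, one_pos, .inl ⟨a, haP, by simp⟩⟩
  by_cases hbP : b ∈ P
  swap
  · exact ⟨1, one_pos, .inr ⟨b, hbP, by simp⟩⟩
  obtain ⟨C, hC, hCP⟩ := h.exists_le hPp (ne_bot_of_mem_maxIdeals hP)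
  obtain ⟨-, Q, hQ, -, hafg⟩ := isTypeOneAfgHomogeneous_iff.1 hC
  obtain rfl := hQ.2.2.2.2 P hP hCP
  obtain ⟨m, hm0, hm⟩ := exists_pow_le_primeSaturation
    (fun N hN hN0 hNP => h.eq_of_le hP hN hN0 hNP) (A := Ideal.span {a}) (by simpa using ha)
    hQ.2.1 hCP
  obtain ⟨T, hT, hTC⟩ := Submodule.fg_def.1 (Submodule.FG.pow hQ.2.1 m)
  have hTsub : T ⊆ (C ^ m : Ideal D) := hTC ▸ Submodule.subset_span
  -- The generators `T` of `Cᵐ ⊆ a D_P` make the afg condition applicable to `a` and `b`.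
  set S : Set D := insert a (insert b T) with hS
  have hSfin : S.Finite := (hT.insert b).insert a
  have hSP : S ⊆ P := by
    refine Set.insert_subset haP (Set.insert_subset hbP (hTsub.trans ?_))
    exact (Ideal.pow_le_self hm0.ne').trans hCP
  obtain ⟨n, hn, d, hd⟩ := hafg S hSfin hSP ⟨m, hm0, by
    rw [← hTC]
    exact (Ideal.span_mono ((Set.subset_insert _ _).trans (Set.subset_insert _ _))).trans
      (star.le_idealCl _)⟩
  have haS : a ^ n ∈ Ideal.span ((· ^ n) '' S) := Ideal.subset_span ⟨a, by simp [hS], rfl⟩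
  have hbS : b ^ n ∈ Ideal.span ((· ^ n) '' S) := Ideal.subset_span ⟨b, by simp [hS], rfl⟩
  have hd0 : d ≠ 0 := by
    rintro rfl
    have := star.le_idealCl _ haS
    rw [hd, Ideal.mem_span_singleton, zero_dvd_iff] at this
    exact ha (eq_zero_of_pow_eq_zero this)
  have hinv := isInvertible_of_idealCl_eq_span_singleton hd0 hd
  obtain ⟨_, ⟨e, he, rfl⟩, s, hs, hsy⟩ :=
    (hinv.isLocallyPrincipalAt hP).exists_generator hinv.ne_bot
  refine ⟨n, hn, ?_⟩
  rcases he with rfl | rfl | he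
  · exact .inl ⟨s, hs, hsy _ hbS⟩
  · exact .inr ⟨s, hs, hsy _ haS⟩
  -- A local generator `eⁿ` with `e ∈ T` is itself divisible by `aⁿ` at `P`, so `aⁿ` generates too.
  · obtain ⟨t, ht, hte⟩ := hm (hTsub he)
    refine .inl ⟨t ^ n * s, fun hmem => ?_, ?_⟩
    · rcases hPp.mem_or_mem hmem with h1 | h1
      · exact ht (hPp.mem_of_pow_mem n h1)
      · exact hs h1
    · have h1 := pow_dvd_pow_of_dvd (Ideal.mem_span_singleton.1 hte) n
      rw [mul_pow] at h1
      rw [mul_assoc]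
      exact h1.trans (mul_dvd_mul_left _ (hsy _ hbS))

theorem isAGKD (h : star.IsTypeOneAfgSHDomain) (hstar : star.IsFiniteCharacter) :
    star.IsAGKD := by
  have heq := h.maxIdeals_eq hstar
  refine ⟨heq ▸ ⟨hstar.isDefiningFamily_maxIdeals, h.isLocallyFiniteFamily⟩, heq, ?_⟩
  exact fun P _ hP => h.isAlmostValuationDomain hP

theorem isHLocal (h : star.IsTypeOneAfgSHDomain) (hstar : star.IsFiniteCharacter) :
    star.IsHLocal := by
  refine ⟨hstar.isDefiningFamily_maxIdeals, ?_, h.isLocallyFiniteFamily⟩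
  rintro P hP Q hQ hPQ ⟨N, hN, hN0, hNP, hNQ⟩
  exact hPQ ((h.eq_of_le hP hN hN0 hNP).symm.trans (h.eq_of_le hQ hN hN0 hNQ))

/-- The afg condition is inherited from any type 1 afg-homogeneous `C ⊆ P`, because a power of `C`
lies in `A_*`. -/
theorem isTypeOneAfgHomogeneous (h : star.IsTypeOneAfgSHDomain) (hstar : star.IsFiniteCharacter)
    {A : Ideal D} (hA : star.IsInvertible (A : FractionalIdeal D⁰ K))
    (hhom : star.IsHomogeneous A) : star.IsTypeOneAfgHomogeneous A := by
  obtain ⟨P, hP⟩ := hhom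
  have hPmem := hP.2.2.1
  have hPp := isPrime_of_mem_maxIdeals hPmem
  have hrad := hP.eq_radical hstar fun N hN hN0 hNP => h.eq_of_le hPmem hN hN0 hNP
  refine isTypeOneAfgHomogeneous_iff.2 ⟨hA, P, hP, hrad, fun S hS hSP ⟨r, hr, hle⟩ => ?_⟩
  obtain ⟨C, hC, hCP⟩ := h.exists_le hPp (ne_bot_of_mem_maxIdeals hPmem)
  obtain ⟨-, Q, hQ, -, hafg⟩ := isTypeOneAfgHomogeneous_iff.1 hC
  obtain rfl := hQ.2.2.2.2 P hPmem hCP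
  obtain ⟨m, hm⟩ := Ideal.exists_pow_le_of_le_radical_of_fg (hCP.trans hrad.le) hQ.2.1
  refine hafg S hS hSP ⟨(m + 1) * r, by positivity, ?_⟩
  rw [pow_mul]
  calc (C ^ (m + 1)) ^ r ≤ star.idealCl A ^ r :=
        Ideal.pow_right_mono ((Ideal.pow_le_pow_right m.le_succ).trans hm) r
    _ ≤ star.idealCl (A ^ r) := star.pow_idealCl_le A r
    _ ≤ star.idealCl (Ideal.span S) := star.idealCl_le_iff.2 hle

end IsTypeOneAfgSHDomain

/-! ### `*`-products and torsion of the `*`-class group. -/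

theorem IsHLocal.isStarProductOf (hloc : star.IsHLocal) (hstar : star.IsFiniteCharacter)
    {p : Ideal D → Prop}
    (h : ∀ A : Ideal D, star.IsInvertible (A : FractionalIdeal D⁰ K) →
      star.IsHomogeneous A → p A) {A : Ideal D} (hfg : A.FG)
    (hA : star.IsInvertible (A : FractionalIdeal D⁰ K)) : star.IsStarProductOf p A := by
  obtain ⟨l, hl, heq⟩ := hloc.exists_list_isHomogeneous hstar hfg hA
  exact star.isStarProductOf_iff.2 ⟨l, fun B hB => h B (hl B hB).1 (hl B hB).2, heq⟩

theorem isTypeOneAfgSHDomain_of_forall_isStarProductOf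
    (h : ∀ A : Ideal D, A.FG → star.IsInvertible (A : FractionalIdeal D⁰ K) →
      star.cl (A : FractionalIdeal D⁰ K) ≠ 1 →
      star.IsStarProductOf star.IsTypeOneAfgHomogeneous A) : star.IsTypeOneAfgSHDomain := by
  intro x hx hu
  refine h _ ⟨{x}, by simp⟩ (isInvertible_span_singleton hx) ?_
  rw [Ne, cl_eq_one_iff, idealCl_span_singleton, Ideal.span_singleton_eq_top]
  exact hu

theorem IsInvertible.coeIdeal_mul {A B : Ideal D}
    (hA : star.IsInvertible (A : FractionalIdeal D⁰ K))
    (hB : star.IsInvertible (B : FractionalIdeal D⁰ K)) :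
    star.IsInvertible ((A * B : Ideal D) : FractionalIdeal D⁰ K) := by
  obtain ⟨A', d, hd, hA'⟩ := star.isInvertible_coeIdeal_iff.1 hA
  obtain ⟨B', e, he, hB'⟩ := star.isInvertible_coeIdeal_iff.1 hB
  refine star.isInvertible_coeIdeal_iff.2 ⟨A' * B', d * e, mul_ne_zero hd he, ?_⟩
  rw [mul_mul_mul_comm, ← idealCl_idealCl_mul, hA', idealCl_span_singleton_mul, hB',
    Ideal.span_singleton_mul_span_singleton]

theorem IsInvertible.coeIdeal_pow {A : Ideal D}
    (hA : star.IsInvertible (A : FractionalIdeal D⁰ K)) (n : ℕ) :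
    star.IsInvertible ((A ^ n : Ideal D) : FractionalIdeal D⁰ K) := by
  induction n with
  | zero =>
    exact isInvertible_of_idealCl_eq_span_singleton one_ne_zero
      (by rw [pow_zero, Ideal.one_eq_top, idealCl_top, Ideal.span_singleton_one])
  | succ n ih =>
    rw [pow_succ]
    exact ih.coeIdeal_mul hA

theorem IsFiniteCharacter.isInvertible_span_pow (hstar : star.IsFiniteCharacter) {S : Set D}
    (hS : star.IsInvertible ((Ideal.span S : Ideal D) : FractionalIdeal D⁰ K)) (n : ℕ) :
    star.IsInvertible ((Ideal.span ((· ^ n) '' S) : Ideal D) : FractionalIdeal D⁰ K) :=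
  (hS.coeIdeal_pow n).of_idealCl_eq (hstar.idealCl_span_pow hS n)

omit [IsDomain D] in
open scoped Pointwise in
theorem exists_fg_le_mul {I J F : Ideal D} (hF : F.FG) (h : F ≤ I * J) :
    ∃ I' : Ideal D, I'.FG ∧ I' ≤ I ∧ F ≤ I' * J := by
  induction F, hF using Submodule.fg_induction with
  | singleton x =>
    obtain ⟨T, T', hT, hT', hx⟩ :=
      Submodule.mem_span_mul_finite_of_mem_mul (h (Ideal.mem_span_singleton_self x))
    refine ⟨Ideal.span T, ⟨T, rfl⟩, Ideal.span_le.2 hT,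
      (Ideal.span_singleton_le_iff_mem _).2 ?_⟩
    have : Submodule.span D ((T : Set D) * (T' : Set D)) ≤ Ideal.span T * J := by
      refine Submodule.span_le.2 ?_
      rintro _ ⟨u, hu, v, hv, rfl⟩
      exact Ideal.mul_mem_mul (Ideal.subset_span hu) (hT' hv)
    exact this hx
  | sup F₁ F₂ h₁ h₂ ih₁ ih₂ =>
    obtain ⟨I₁, hfg₁, hle₁, hF₁⟩ := ih₁ (le_sup_left.trans h)
    obtain ⟨I₂, hfg₂, hle₂, hF₂⟩ := ih₂ (le_sup_right.trans h)
    refine ⟨I₁ ⊔ I₂, Submodule.FG.sup hfg₁ hfg₂, sup_le hle₁ hle₂, ?_⟩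
    rw [Ideal.sup_mul]
    exact sup_le_sup hF₁ hF₂

/-- If `(AC)_* = dD`, the membership of `d` uses only finitely many elements of `A`. They generate
`B` with `(BC)_* = dD`, and `d A_*` and `d B_*` both equal `(ABC)_*`. -/
theorem IsInvertible.exists_fg (hstar : star.IsFiniteCharacter) {A : Ideal D}
    (hA : star.IsInvertible (A : FractionalIdeal D⁰ K)) :
    ∃ B : Ideal D, B.FG ∧ star.idealCl A = star.idealCl B := by
  obtain ⟨C, d, hd, h⟩ := star.isInvertible_coeIdeal_iff.1 hA
  obtain ⟨F, hF, hFle, hdF⟩ := hstar.exists_fg (h.symm ▸ Ideal.mem_span_singleton_self d)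
  obtain ⟨B, hB, hBA, hFB⟩ := exists_fg_le_mul hF hFle
  have hBC : star.idealCl (B * C) = Ideal.span {d} := by
    refine le_antisymm ?_ ((Ideal.span_singleton_le_iff_mem _).2 (star.idealCl_mono hFB hdF))
    rw [← h]
    exact star.idealCl_mono (Ideal.mul_mono_left hBA)
  refine ⟨B, hB, span_singleton_mul_cancel hd ?_⟩
  rw [← star.idealCl_span_singleton_mul, ← star.idealCl_span_singleton_mul]
  nth_rw 1 [← hBC]
  rw [← h, idealCl_idealCl_mul, idealCl_idealCl_mul]
  congr 1
  ring

variable (star) in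
/-- Some positive power of `A` has principal closure. -/
def IsTorsionIdeal (A : Ideal D) : Prop :=
  ∃ n : ℕ, 0 < n ∧ ∃ d : D, star.idealCl (A ^ n) = Ideal.span {d}

theorem idealCl_pow_of_eq_span_singleton {A : Ideal D} {d : D}
    (h : star.idealCl A = Ideal.span {d}) (n : ℕ) :
    star.idealCl (A ^ n) = Ideal.span {d ^ n} := by
  rw [← idealCl_pow_idealCl, h, Ideal.span_singleton_pow, idealCl_span_singleton]

theorem IsTorsionIdeal.mul {A B : Ideal D} (hA : star.IsTorsionIdeal A)
    (hB : star.IsTorsionIdeal B) : star.IsTorsionIdeal (A * B) := by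
  obtain ⟨n, hn, d, hd⟩ := hA
  obtain ⟨m, hm, e, he⟩ := hB
  refine ⟨n * m, Nat.mul_pos hn hm, d ^ m * e ^ n, ?_⟩
  rw [mul_pow, pow_mul A, mul_comm n m, pow_mul B, ← idealCl_idealCl_mul,
    idealCl_pow_of_eq_span_singleton hd, idealCl_span_singleton_mul,
    idealCl_pow_of_eq_span_singleton he, Ideal.span_singleton_mul_span_singleton]

theorem IsTorsionIdeal.list_prod {l : List (Ideal D)} (h : ∀ A ∈ l, star.IsTorsionIdeal A) :
    star.IsTorsionIdeal l.prod := by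
  induction l with
  | nil =>
    exact ⟨1, one_pos, 1, by
      rw [List.prod_nil, one_pow, Ideal.one_eq_top, idealCl_top, Ideal.span_singleton_one]⟩
  | cons A l ih =>
    rw [List.prod_cons]
    exact (h A List.mem_cons_self).mul (ih fun B hB => h B (List.mem_cons_of_mem A hB))

theorem IsTorsionIdeal.of_idealCl_eq {A B : Ideal D} (hA : star.IsTorsionIdeal A)
    (h : star.idealCl A = star.idealCl B) : star.IsTorsionIdeal B := by
  obtain ⟨n, hn, d, hd⟩ := hA
  exact ⟨n, hn, d, by rw [← hd, ← idealCl_pow_idealCl, ← h, idealCl_pow_idealCl]⟩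

/-- Apply the afg condition to generators of `A` itself, with `r = 1`. -/
theorem IsTypeOneAfgHomogeneous.isTorsionIdeal (hstar : star.IsFiniteCharacter) {A : Ideal D}
    (hA : star.IsTypeOneAfgHomogeneous A) : star.IsTorsionIdeal A := by
  obtain ⟨hinv, P, hP, -, h⟩ := isTypeOneAfgHomogeneous_iff.1 hA
  obtain ⟨S, hS, rfl⟩ := Submodule.fg_def.1 hP.2.1
  obtain ⟨n, hn, d, hd⟩ := h S hS (Ideal.subset_span.trans hP.2.2.2.1)
    ⟨1, one_pos, (pow_one _).le.trans (star.le_idealCl _)⟩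
  exact ⟨n, hn, d, (hstar.idealCl_span_pow hinv n).trans hd⟩

theorem IsTypeOneAfgSHDomain.isTorsionIdeal (h : star.IsTypeOneAfgSHDomain)
    (hstar : star.IsFiniteCharacter) {A : Ideal D} (hfg : A.FG)
    (hA : star.IsInvertible (A : FractionalIdeal D⁰ K)) : star.IsTorsionIdeal A := by
  obtain ⟨l, hl, heq⟩ := star.isStarProductOf_iff.1 ((h.isHLocal hstar).isStarProductOf hstar
    (fun B hB hBhom => h.isTypeOneAfgHomogeneous hstar hB hBhom) hfg hA)
  exact (IsTorsionIdeal.list_prod fun B hB => (hl B hB).isTorsionIdeal hstar).of_idealCl_eq heq.symm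

theorem Inv.val_pow (A : star.Inv) (n : ℕ) : (A ^ n).1 = star.cl (A.1 ^ n) := by
  induction n with
  | zero =>
    rw [pow_zero, pow_zero, star.cl_one]
    rfl
  | succ n ih =>
    rw [pow_succ, pow_succ]
    change star.cl ((A ^ n).1 * A.1) = _
    rw [ih, cl_cl_mul]

/-- Scaling makes a representative integral, and a `*`-invertible ideal shares its closure with a
finitely generated one. -/
theorem isMulTorsion_classGroup_iff (hstar : star.IsFiniteCharacter) :
    IsMulTorsion star.ClassGroup ↔ ∀ A : Ideal D, A.FG →
      star.IsInvertible (A : FractionalIdeal D⁰ K) → star.IsTorsionIdeal A := by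
  constructor
  · intro h A _ hA
    have hA' : star.IsInvertible (star.idealCl A : FractionalIdeal D⁰ K) :=
      hA.of_idealCl_eq (star.idealCl_idealCl A).symm
    let a : star.Inv := ⟨star.idealCl A, hA', by rw [coeIdeal_idealCl, star.cl_cl]⟩
    obtain ⟨n, hn, hpow⟩ := isOfFinOrder_iff_pow_eq_one.1 (h (a : star.ClassGroup))
    rw [← QuotientGroup.mk_pow, QuotientGroup.eq_one_iff] at hpow
    obtain ⟨x, hx⟩ := hpow
    refine ⟨n, hn, star.isPrincipalFractional_cl_iff.1 ⟨x, ?_⟩⟩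
    have h1 : (a ^ n).1 = spanSingleton D⁰ (x : K) := (congrArg Subtype.val hx).symm
    rw [← h1, Inv.val_pow, ← FractionalIdeal.coeIdeal_pow, ← idealCl_eq_iff,
      idealCl_pow_idealCl]
  · intro h a
    induction a using QuotientGroup.induction_on with
    | H a =>
      obtain ⟨d, I, hd, hI⟩ := exists_eq_spanSingleton_mul a.1
      have hd' : (algebraMap D K d)⁻¹ ≠ 0 := by simpa using hd
      have hIinv : star.IsInvertible (I : FractionalIdeal D⁰ K) := by
        refine star.isInvertible_of_mul (B := spanSingleton D⁰ (algebraMap D K d)⁻¹ * a.1⁻¹) ?_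
        rw [mul_left_comm, ← mul_assoc, ← hI]
        exact a.2.1.2
      obtain ⟨B, hB, hIB⟩ := hIinv.exists_fg hstar
      obtain ⟨n, hn, e, he⟩ := (h B hB (hIinv.of_idealCl_eq hIB)).of_idealCl_eq hIB.symm
      have hval : (a ^ n).1 =
          spanSingleton D⁰ ((algebraMap D K d)⁻¹ ^ n * algebraMap D K e) := by
        rw [Inv.val_pow, hI, mul_pow, spanSingleton_pow, cl_spanSingleton_mul,
          ← FractionalIdeal.coeIdeal_pow, ← coeIdeal_idealCl, he, coeIdeal_span_singleton,
          spanSingleton_mul_spanSingleton]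
      have hne : (algebraMap D K d)⁻¹ ^ n * algebraMap D K e ≠ 0 := by
        intro h0
        rw [h0, spanSingleton_zero] at hval
        exact (a ^ n).2.1.1 hval
      refine isOfFinOrder_iff_pow_eq_one.2 ⟨n, hn, ?_⟩
      rw [← QuotientGroup.mk_pow, QuotientGroup.eq_one_iff]
      exact ⟨Units.mk0 _ hne, Subtype.ext hval.symm⟩

end StarOperation

/-! ### Almost valuation localizations. -/

section AlmostValuation

variable {D : Type*} [CommRing D] [IsDomain D] {P : Ideal D} [hP : P.IsPrime]

omit [IsDomain D] in
theorem exists_pow_dvd_mul_pow {a b : D} {n : ℕ} (h : ∃ s ∉ P, a ^ n ∣ s * b ^ n) (m : ℕ) :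
    ∃ s ∉ P, a ^ (n * m) ∣ s * b ^ (n * m) := by
  obtain ⟨s, hs, hab⟩ := h
  refine ⟨s ^ m, fun h => hs (hP.mem_of_pow_mem m h), ?_⟩
  have := pow_dvd_pow_of_dvd hab m
  rwa [mul_pow, ← pow_mul, ← pow_mul] at this

omit [IsDomain D] in
theorem exists_dvd_mul_trans {a b c : D} (h₁ : ∃ s ∉ P, a ∣ s * b) (h₂ : ∃ s ∉ P, b ∣ s * c) :
    ∃ s ∉ P, a ∣ s * c := by
  obtain ⟨s, hs, hab⟩ := h₁
  obtain ⟨t, ht, hbc⟩ := h₂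
  refine ⟨s * t, fun h => (hP.mem_or_mem h).elim hs ht, ?_⟩
  rw [mul_assoc]
  exact hab.trans (mul_dvd_mul_left s hbc)

theorem IsAlmostValuationDomain.exists_pow (h : IsAlmostValuationDomain (Localization.AtPrime P))
    (a b : D) : ∃ n : ℕ, 0 < n ∧ ((∃ s ∉ P, a ^ n ∣ s * b ^ n) ∨ ∃ s ∉ P, b ^ n ∣ s * a ^ n) := by
  by_cases ha : a = 0
  · exact ⟨1, one_pos, .inr ⟨1, P.one_notMem, by simp [ha]⟩⟩
  by_cases hb : b = 0
  · exact ⟨1, one_pos, .inl ⟨1, P.one_notMem, by simp [hb]⟩⟩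
  exact (isAlmostValuationDomain_localization_iff P).1 h a b ha hb

/-- Local divisibility of `n`-th powers persists for multiples of `n`, so comparing the new element
with the current smallest one only enlarges the common exponent. -/
theorem IsAlmostValuationDomain.exists_pow_of_finite
    (h : IsAlmostValuationDomain (Localization.AtPrime P)) {S : Set D} (hS : S.Finite)
    (hne : S.Nonempty) :
    ∃ n : ℕ, 0 < n ∧ ∃ a ∈ S, ∀ b ∈ S, ∃ s ∉ P, a ^ n ∣ s * b ^ n := by
  induction S, hS using Set.Finite.induction_on with
  | empty => exact (Set.not_nonempty_empty hne).elim
  | @insert x S hx hS ih =>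
    rcases S.eq_empty_or_nonempty with rfl | hne'
    · refine ⟨1, one_pos, x, by simp, fun b hb => ⟨1, P.one_notMem, ?_⟩⟩
      rw [insert_empty_eq, Set.mem_singleton_iff] at hb
      simp [hb]
    · obtain ⟨n, hn, a, haS, ha⟩ := ih hne'
      obtain ⟨m, hm, hxa⟩ := h.exists_pow (x ^ n) (a ^ n)
      simp only [← pow_mul] at hxa
      refine ⟨n * m, Nat.mul_pos hn hm, ?_⟩
      rcases hxa with hxa | hxa
      · refine ⟨x, Set.mem_insert _ _, fun b hb => ?_⟩
        rcases hb with rfl | hb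
        · exact ⟨1, P.one_notMem, by simp⟩
        · exact exists_dvd_mul_trans hxa (exists_pow_dvd_mul_pow (ha b hb) m)
      · refine ⟨a, Set.mem_insert_of_mem _ haS, fun b hb => ?_⟩
        rcases hb with rfl | hb
        · exact hxa
        · exact exists_pow_dvd_mul_pow (ha b hb) m

end AlmostValuation

namespace StarOperation

open FractionalIdeal

variable {D : Type*} [CommRing D] [IsDomain D]
variable {K : Type*} [Field K] [Algebra D K] [IsFractionRing D K]
variable {star : StarOperation D K}

/-! ### `*`-almost generalized Krull domains. -/

namespace IsAGKD

theorem eq_of_le (h : star.IsAGKD) {P : Ideal D} (hP : P ∈ star.maxIdeals)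
    {N : Ideal D} (hN : N.IsPrime) (hN0 : N ≠ ⊥) (hNP : N ≤ P) : N = P :=
  (mem_heightOnePrimes_iff.1 (h.2.1 ▸ hP)).2.2 N hN hN0 hNP

theorem isHLocal (h : star.IsAGKD) : star.IsHLocal := by
  refine ⟨h.2.1 ▸ h.1.1, ?_, h.2.1 ▸ h.1.2⟩
  rintro P hP Q hQ hPQ ⟨N, hN, hN0, hNP, hNQ⟩
  exact hPQ ((h.eq_of_le hP hN hN0 hNP).symm.trans (h.eq_of_le hQ hN hN0 hNQ))

theorem isTypeOneAfgHomogeneous (h : star.IsAGKD) (hstar : star.IsFiniteCharacter)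
    (htors : ∀ A : Ideal D, A.FG → star.IsInvertible (A : FractionalIdeal D⁰ K) →
      star.IsTorsionIdeal A) {A : Ideal D} (hA : star.IsInvertible (A : FractionalIdeal D⁰ K))
    (hhom : star.IsHomogeneous A) : star.IsTypeOneAfgHomogeneous A := by
  obtain ⟨P, hP⟩ := hhom
  have hPmem := hP.2.2.1
  have hPp := isPrime_of_mem_maxIdeals hPmem
  have hrad := hP.eq_radical hstar fun N hN hN0 hNP => h.eq_of_le hPmem hN hN0 hNP
  refine isTypeOneAfgHomogeneous_iff.2 ⟨hA, P, hP, hrad, fun S hS hSP ⟨r, hr, hle⟩ => ?_⟩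
  have hS0 : Ideal.span S ≠ ⊥ := by
    intro h0
    rw [h0, idealCl_bot, le_bot_iff] at hle
    exact hP.1 (eq_zero_of_pow_eq_zero hle)
  have hSne : S.Nonempty := Set.nonempty_iff_ne_empty.2 fun h0 => hS0 (by simp [h0])
  obtain ⟨n, hn, a, haS, ha⟩ := (h.2.2 P hPmem).exists_pow_of_finite hS hSne
  have hinv : star.IsInvertible
      ((Ideal.span ((· ^ n) '' S) : Ideal D) : FractionalIdeal D⁰ K) := by
    refine hstar.isInvertible ?_ fun Q hQ => ?_
    · exact fun h0 => hS0 (Ideal.span_eq_bot.2 fun x hx =>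
        eq_zero_of_pow_eq_zero (Ideal.span_eq_bot.1 h0 _ ⟨x, hx, rfl⟩))
    · have hQp := isPrime_of_mem_maxIdeals hQ
      by_cases hQP : Q = P
      · subst hQP
        refine .of_span (hS.image _) ⟨a, haS, rfl⟩ ?_
        rintro _ ⟨b, hb, rfl⟩
        exact ha b hb
      -- If `Q` contained all `bⁿ`, it would contain `(S)_* ⊇ Aʳ`, hence `A`, forcing `Q = P`.
      · refine .of_not_le fun hle' => hQP (hP.2.2.2.2 Q hQ ?_)
        refine hQp.le_of_pow_le (n := r) (hle.trans (idealCl_le_of_mem_maxIdeals hQ ?_))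
        exact Ideal.span_le.2 fun x hx =>
          hQp.mem_of_pow_mem n (hle' (Ideal.subset_span ⟨x, hx, rfl⟩))
  obtain ⟨k, hk, d, hd⟩ := htors _ (Submodule.fg_def.2 ⟨_, hS.image _, rfl⟩) hinv
  refine ⟨n * k, Nat.mul_pos hn hk, d, ?_⟩
  rw [← hd, hstar.idealCl_span_pow hinv, Set.image_image]
  simp only [← pow_mul]

/-- Multiply the local AV exponents over the finitely many `P` containing `a`. At every other `P`,
the powers of `a` are locally units. -/
theorem exists_isInvertible_span_pair (h : star.IsAGKD) (hstar : star.IsFiniteCharacter)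
    {a b : D} (ha : a ≠ 0) : ∃ n : ℕ, 0 < n ∧
      star.IsInvertible ((Ideal.span {a ^ n, b ^ n} : Ideal D) : FractionalIdeal D⁰ K) := by
  have hfin : {P ∈ star.maxIdeals | Ideal.span {a} ≤ P}.Finite :=
    finite_setOf_le h.isHLocal.2.2 (fun Q hQ => (isPrime_of_mem_maxIdeals hQ).ne_top)
      (by simpa using ha)
  have hex : ∀ P : Ideal D, ∃ n : ℕ, 0 < n ∧ (P ∈ star.maxIdeals →
      ((∃ s ∉ P, a ^ n ∣ s * b ^ n) ∨ ∃ s ∉ P, b ^ n ∣ s * a ^ n)) := by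
    intro P
    by_cases hP : P ∈ star.maxIdeals
    · have hPp := isPrime_of_mem_maxIdeals hP
      obtain ⟨n, hn, hab⟩ := (h.2.2 P hP).exists_pow a b
      exact ⟨n, hn, fun _ => hab⟩
    · exact ⟨1, one_pos, fun h => (hP h).elim⟩
  choose n hn hab using hex
  refine ⟨∏ P ∈ hfin.toFinset, n P, Finset.prod_pos fun P _ => hn P,
    hstar.isInvertible ?_ fun P hP => ?_⟩
  · exact fun h0 => ha (eq_zero_of_pow_eq_zero (Ideal.span_eq_bot.1 h0 _ (Set.mem_insert _ _)))
  · have hPp := isPrime_of_mem_maxIdeals hP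
    by_cases haP : a ∈ P
    · obtain ⟨m, hm⟩ : n P ∣ ∏ P ∈ hfin.toFinset, n P :=
        Finset.dvd_prod_of_mem n (hfin.mem_toFinset.2
          ⟨hP, (Ideal.span_singleton_le_iff_mem _).2 haP⟩)
      rw [hm]
      have hself : ∀ c : D, ∃ s ∉ P, c ∣ s * c := fun c => ⟨1, P.one_notMem, by simp⟩
      rcases hab P hP with hab | hab
      · refine .of_span (Set.toFinite _) (Set.mem_insert _ _) ?_
        rintro c (rfl | rfl)
        · exact hself _
        · exact exists_pow_dvd_mul_pow hab m
      · refine .of_span (Set.toFinite _) (Set.mem_insert_of_mem _ rfl) ?_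
        rintro c (rfl | rfl)
        · exact exists_pow_dvd_mul_pow hab m
        · exact hself _
    · exact .of_not_le fun hle => haP
        (hPp.mem_of_pow_mem _ (hle (Ideal.subset_span (Set.mem_insert _ _))))

theorem isAGCDDomain (h : star.IsAGKD) (hstar : star.IsFiniteCharacter)
    (htors : ∀ A : Ideal D, A.FG → star.IsInvertible (A : FractionalIdeal D⁰ K) →
      star.IsTorsionIdeal A) : IsAGCDDomain D K := by
  intro a b ha _
  obtain ⟨n, hn, hinv⟩ := h.exists_isInvertible_span_pair hstar (b := b) ha
  obtain ⟨k, hk, d, hd⟩ := htors _ (Submodule.fg_def.2 ⟨_, Set.toFinite _, rfl⟩) hinv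
  have hinv' := hstar.isInvertible_span_pow hinv k
  rw [hstar.idealCl_span_pow hinv] at hd
  rw [Set.image_pair, ← pow_mul, ← pow_mul] at hinv' hd
  refine ⟨n * k, Nat.mul_pos hn hk, ?_⟩
  rw [hinv'.inv_inv]
  exact star.isPrincipalFractional_cl_iff.2 ⟨d, hd⟩

theorem exists_idealCl_span_pair (h : star.IsAGKD) (hstar : star.IsFiniteCharacter)
    (hgcd : IsAGCDDomain D K) {a b : D} (ha : a ≠ 0) (hb : b ≠ 0) :
    ∃ n : ℕ, 0 < n ∧ ∃ d : D, star.idealCl (Ideal.span {a ^ n, b ^ n}) = Ideal.span {d} := by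
  obtain ⟨n, hn, hinv⟩ := h.exists_isInvertible_span_pair hstar (b := b) ha
  obtain ⟨m, hm, hprin⟩ := hgcd (a ^ n) (b ^ n) (pow_ne_zero n ha) (pow_ne_zero n hb)
  have hinv' := hstar.isInvertible_span_pow hinv m
  rw [Set.image_pair] at hinv'
  rw [hinv'.inv_inv] at hprin
  refine ⟨n * m, Nat.mul_pos hn hm, ?_⟩
  rw [pow_mul, pow_mul]
  exact star.isPrincipalFractional_cl_iff.1 hprin

/-- Once the `n`-th powers of `S` have closure `dD`, adding `b` reduces to the pair `bⁿ, d`. -/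
theorem exists_idealCl_span_pow (h : star.IsAGKD) (hstar : star.IsFiniteCharacter)
    (hgcd : IsAGCDDomain D K) {S : Set D} (hS : S.Finite) :
    ∃ n : ℕ, 0 < n ∧ ∃ d : D, star.idealCl (Ideal.span ((· ^ n) '' S)) = Ideal.span {d} := by
  induction S, hS using Set.Finite.induction_on with
  | empty => exact ⟨1, one_pos, 0, by simp [idealCl_bot]⟩
  | @insert b S _ _ ih =>
    obtain ⟨n, hn, d, hd⟩ := ih
    by_cases hd0 : d = 0
    · refine ⟨n, hn, b ^ n, ?_⟩
      rw [Set.image_insert_eq, Ideal.span_insert, ← idealCl_sup_idealCl, hd, hd0,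
        Ideal.span_singleton_zero, sup_bot_eq, idealCl_span_singleton]
    by_cases hb : b = 0
    · refine ⟨n, hn, d, ?_⟩
      rw [Set.image_insert_eq, Ideal.span_insert, hb, zero_pow hn.ne',
        Ideal.span_singleton_zero, bot_sup_eq, hd]
    · have hinv := isInvertible_of_idealCl_eq_span_singleton hd0 hd
      obtain ⟨m, hm, e, he⟩ :=
        h.exists_idealCl_span_pair hstar hgcd (pow_ne_zero n hb) hd0
      refine ⟨n * m, Nat.mul_pos hn hm, e, ?_⟩
      -- A principal closure with `d ≠ 0` means `*`-invertible, so raising generators to powers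
      -- commutes with closure.
      have hpow : star.idealCl (Ideal.span ((· ^ (n * m)) '' S)) = Ideal.span {d ^ m} := by
        rw [← idealCl_pow_of_eq_span_singleton hd m, hstar.idealCl_span_pow hinv, Set.image_image]
        simp only [← pow_mul]
      rw [Set.image_insert_eq, Ideal.span_insert, ← idealCl_sup_idealCl, hpow, ← he,
        Ideal.span_insert, pow_mul]

theorem isTorsionIdeal (h : star.IsAGKD) (hstar : star.IsFiniteCharacter)
    (hgcd : IsAGCDDomain D K) {A : Ideal D} (hfg : A.FG)
    (hA : star.IsInvertible (A : FractionalIdeal D⁰ K)) : star.IsTorsionIdeal A := by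
  obtain ⟨S, hS, rfl⟩ := Submodule.fg_def.1 hfg
  obtain ⟨n, hn, d, hd⟩ := h.exists_idealCl_span_pow hstar hgcd hS
  exact ⟨n, hn, d, (hstar.idealCl_span_pow hA n).trans hd⟩

end IsAGKD

end StarOperation

/-! ### The equivalence. -/

theorem corollary5p7 {D : Type*} [CommRing D] [IsDomain D]
    {K : Type*} [Field K] [Algebra D K] [IsFractionRing D K]
    (star : StarOperation D K) (hstar : star.IsFiniteCharacter) :
    List.TFAE [
      star.IsTypeOneAfgSHDomain,
      star.IsAGKD ∧ IsAGCDDomain D K,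
      star.IsHLocal ∧ ∀ A : Ideal D, star.IsInvertible (A : FractionalIdeal D⁰ K) →
        star.IsHomogeneous A → star.IsTypeOneAfgHomogeneous A,
      ∀ A : Ideal D, A.FG → star.IsInvertible (A : FractionalIdeal D⁰ K) →
        star.cl (A : FractionalIdeal D⁰ K) ≠ 1 →
        star.IsStarProductOf star.IsTypeOneAfgHomogeneous A,
      star.IsAGKD ∧ IsMulTorsion star.ClassGroup] := by
  rw [StarOperation.isMulTorsion_classGroup_iff hstar]
  tfae_have 3 → 4 := fun h A hfg hA _ => h.1.isStarProductOf hstar h.2 hfg hA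
  tfae_have 4 → 1 := StarOperation.isTypeOneAfgSHDomain_of_forall_isStarProductOf
  tfae_have 1 → 5 := fun h =>
    ⟨h.isAGKD hstar, fun A hfg hA => h.isTorsionIdeal hstar hfg hA⟩
  tfae_have 5 → 3 := fun h =>
    ⟨h.1.isHLocal, fun A hA hhom => h.1.isTypeOneAfgHomogeneous hstar h.2 hA hhom⟩
  tfae_have 5 → 2 := fun h => ⟨h.1, h.1.isAGCDDomain hstar h.2⟩
  tfae_have 2 → 5 := fun h => ⟨h.1, fun A hfg hA => h.1.isTorsionIdeal hstar h.2 hfg hA⟩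
  tfae_finish
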